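/- **Theorem 1.4.** Let $v$ and $k$ be positive integers with $v+k$ even, let $b_1,\dots,b_v$ and $c_1,\dots,c_k$ be positive integers, and put $\mathbf h=c_1+\cdots+c_k$. For $\tau$ in the upper half plane write $q^{x}=e^{2\pi i x\tau}$ for real $x$, and $q=q^1$. Let $$\theta(\tau)=\sum_{n\in\mathbb Z}q^{n^2},\qquad \Psi(\tau)=\sum_{n=0}^{\infty}q^{n(n+1)/2},\qquad \psi_{s,t}(\tau)=\prod_{i=1}^{v}\theta(b_i\tau)\prod_{j=1}^{k}\Psi(c_j\tau),$$ so that $\psi_{s,t}$ is the generating function of the mixed form $\sum_{i=1}^v b_iy_i^2+\sum_{j=1}^k c_j\frac{z_j(z_j+1)}2$ ($y_i\in\mathbb Z$, $z_j\in\mathbb Z_{\ge 0}$). Set $$M=\operatorname{lcm}\bigl[\,4\operatorname{lcm}[b_1,\dots,b_v],\ 2\operatorname{lcm}[c_1,\dots,c_k]\,\bigr]$$ and let $\chi''$ be given by the Kronecker symbol $$\chi''=\begin{cases}\left(\dfrac{(-1)^{(v+k)/2}\,4\prod_{i=1}^v b_i\prod_{j=1}^k c_j}{\cdot}\right)&\text{if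 } v \text{ and } k \text{ are even},\\[2ex]\left(\dfrac{(-1)^{(v+k)/2}\,8\prod_{i=1}^v b_i\prod_{j=1}^k c_j}{\cdot}\right)&\text{if } v \text{ and } k \text{ are odd}.\end{cases}$$ Then the function $q^{\mathbf h/8}\psi_{s,t}(\tau)$ lies in $M_{(v+k)/2}(\Gamma_0(M),\chi'')$ if and only if $\mathbf h\equiv 0\pmod 8$. Here $M_w(\Gamma_0(M),\chi)$ is the space of holomorphic functions $f$ on the upper half plane that satisfy $f\left(\frac{\alpha\tau+\beta}{\gamma\tau+\delta}\right)=\chi(\delta)(\gamma\tau+\delta)^wf(\tau)$ for all $\begin{pmatrix}\alpha&\beta\\ \gamma&\delta\end{pmatrix}\in\Gamma_0(M)$ and are holomorphic at all cusps. In particular (the case of odd $v$ and $k$), an odd number of squares and an odd number of triangular numbers combine to give integral weight. -/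

import Mathlib

open UpperHalfPlane CongruenceSubgroup
open scoped MatrixGroups ModularForm Manifold NumberTheorySymbols

noncomputable section

/-- The classical theta function `θ(τ) = ∑_{n ∈ ℤ} q ^ (n ^ 2)`, with `q = exp (2 π i τ)`. -/
def squareTheta (τ : ℂ) : ℂ :=
  ∑' n : ℤ, Complex.exp (2 * Real.pi * Complex.I * (n : ℂ) ^ 2 * τ)

/-- The generating function of the triangular numbers `Ψ(τ) = ∑_{n ≥ 0} q ^ (n (n + 1) / 2)`,
with `q = exp (2 π i τ)`. -/
def triangularPsi (τ : ℂ) : ℂ :=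
  ∑' n : ℕ, Complex.exp (2 * Real.pi * Complex.I * ((n : ℂ) * ((n : ℂ) + 1) / 2) * τ)

/-- The generating function `ψ(τ) = ∏ i, θ(b i τ) * ∏ j, Ψ(c j τ)` of the mixed form
`∑ i, b i * y i ^ 2 + ∑ j, c j * (z j (z j + 1) / 2)`. -/
def mixedGen {v k : ℕ} (b : Fin v → ℕ) (c : Fin k → ℕ) (τ : ℍ) : ℂ :=
  (∏ i, squareTheta ((b i : ℂ) * τ)) * ∏ j, triangularPsi ((c j : ℂ) * τ)

/-- The Kronecker symbol `(a / n)` for arbitrary integers `a`, `n`: completely multiplicative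
in the lower argument `n ≠ 0`, equal to the Legendre symbol at odd primes, with `(a / 2)` equal
to `0`, `1`, `-1` for `a` even, `a ≡ ± 1`, `a ≡ ± 3` modulo `8`, with `(a / -1)` equal to `-1`
exactly when `a < 0`, and with `(a / 0)` equal to `1` if `a = ± 1` and to `0` otherwise. -/
def kroneckerSymbol (a n : ℤ) : ℤ :=
  if n = 0 then (if a.natAbs = 1 then 1 else 0)
  else (if n < 0 ∧ a < 0 then -1 else 1) *
    (ZMod.χ₈ (a : ZMod 8)) ^ (n.natAbs.factorization 2) *
    J(a | n.natAbs / 2 ^ (n.natAbs.factorization 2))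

/-- The space `M_w(Γ₀(N), χ)` of modular forms of weight `w`, level `N` and character `χ`:
holomorphic functions `f` on the upper half plane with
`f((aτ + b)/(cτ + d)) = χ(d) (cτ + d) ^ w f(τ)` for all `(a, b; c, d) ∈ Γ₀(N)`,
which are holomorphic at all cusps, i.e. `f ∣[w] γ` is bounded as `Im τ → ∞`
for every `γ ∈ SL₂(ℤ)`. -/
def modularFormSpace (N : ℕ) (w : ℤ) (χ : ℤ → ℂ) : Submodule ℂ (ℍ → ℂ) where
  carrier := {f | MDiff f ∧
    (∀ γ ∈ Gamma0 N, ∀ τ : ℍ,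
      f (γ • τ) = χ (γ 1 1) * ((γ 1 0 : ℂ) * (τ : ℂ) + (γ 1 1 : ℂ)) ^ w * f τ) ∧
    ∀ γ : SL(2, ℤ), IsBoundedAtImInfty (f ∣[w] γ)}
  zero_mem' := by
    refine ⟨mdifferentiable_const, fun γ _ τ => by simp, fun γ => ?_⟩
    rw [SlashAction.zero_slash]
    exact zero_form_isBoundedAtImInfty
  add_mem' := by
    rintro f g ⟨hf1, hf2, hf3⟩ ⟨hg1, hg2, hg3⟩
    refine ⟨hf1.add hg1, fun γ hγ τ => ?_, fun γ => ?_⟩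
    · simp only [Pi.add_apply, hf2 γ hγ τ, hg2 γ hγ τ, mul_add]
    · rw [SlashAction.add_slash]
      exact (hf3 γ).add (hg3 γ)
  smul_mem' := by
    rintro a f ⟨hf1, hf2, hf3⟩
    refine ⟨hf1.const_smul a, fun γ hγ τ => ?_, fun γ => ?_⟩
    · simp only [Pi.smul_apply, smul_eq_mul, hf2 γ hγ τ]
      ring
    · rw [ModularForm.SL_smul_slash]
      exact (hf3 γ).const_smul_left a

/-- The level `M = lcm[4 lcm[b_1, …, b_v], 2 lcm[c_1, …, c_k]]`. -/
def mixedLevel {v k : ℕ} (b : Fin v → ℕ) (c : Fin k → ℕ) : ℕ :=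
  Nat.lcm (4 * Finset.univ.lcm b) (2 * Finset.univ.lcm c)

/-- The integer `(-1) ^ ((v + k) / 2) * 4 * ∏ b_i * ∏ c_j` for `v`, `k` even, and
`(-1) ^ ((v + k) / 2) * 8 * ∏ b_i * ∏ c_j` for `v`, `k` odd. -/
def mixedDisc {v k : ℕ} (b : Fin v → ℕ) (c : Fin k → ℕ) : ℤ :=
  (-1) ^ ((v + k) / 2) * (if Even v ∧ Even k then 4 else 8) *
    (∏ i, (b i : ℤ)) * ∏ j, (c j : ℤ)

end

/-!
The theta series `∑ exp (π i (n + ρ) ^ 2 τ)` of characteristic `ρ = 0` and `ρ = 1 / 2` are, up to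
scaling, the functions `θ` and `q ^ (1 / 8) Ψ`. For a matrix `(a, b; c, d)` with `c` even and
`d > 0` odd, the image of `τ` is `b / d + w` with `w = τ / (d (c τ + d))`. Splitting the series
along residues modulo `d`, applying Poisson summation in each class and completing the square gives
back the series at `τ`, multiplied by a quotient of principal square roots and by a finite
exponential sum (`thetaChar_smul`). That sum is a quadratic Gauss sum `G(x; d)`, for `ρ = 1 / 2`
together with the eighth root of unity `exp (2 π i b d / 8)`.

In the product of `v + k` such series the quotients of square roots are all equal and `v + k` is
even, so no choice of branch matters, and neither does the sign of the Gauss sum: besides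
`G(x; d) = (x / d) G(1; d)` only `G(1; d) ^ 2 = (-1 / d) d` is needed
(`quadGauss_eq_jacobiSym_mul_and_sq`, by induction on `d`). The roots of unity cancel when
`8 ∣ ∑ c_j`, and the Jacobi symbols combine to the character (`jacobiSym_mixedDisc`). Matrices with
`d < 0` reduce to their negatives.

At the cusps no expansion is computed. A theta series is `O(1 + y ^ (-1 / 2))`, hence the transform
of the product by `γ ∈ SL₂(ℤ)` is bounded high up in a vertical strip, and it is invariant under
translation by the level up to a factor of absolute value at most one
(`isBoundedAtImInfty_slash_of_growth`).

Conversely, `τ ↦ τ + 1` belongs to `Γ₀(M)` and multiplies the function, which does not vanish at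
`i`, by `exp (2 π i ∑ c_j / 8)`, so modularity forces `8 ∣ ∑ c_j`.
-/

/-! ### Quadratic Gauss sums to odd moduli -/

/-- A sum of a function of period `d` over a complete residue system modulo `d`, here any family
`g` of `d` pairwise incongruent integers, is its sum over `0, …, d - 1`. -/
lemma sum_residueSystem {ι : Type*} [Fintype ι] {d : ℕ} [NeZero d] {f : ℤ → ℂ}
    (hf : ∀ n, f (n + d) = f n) (g : ι → ℤ) (hcard : Fintype.card ι = d)
    (hinj : ∀ i j, (d : ℤ) ∣ g i - g j → i = j) :
    ∑ i, f (g i) = ∑ r : Fin d, f ((r : ℕ) : ℤ) := by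
  have hper : Function.Periodic f (d : ℤ) := hf
  have hF : ∀ n : ℤ, f n = f ((n : ZMod d).val : ℤ) := fun n => by
    rw [ZMod.val_intCast]
    conv_lhs => rw [← Int.emod_add_mul_ediv n d, mul_comm]
    exact hper.int_mul (n / d) (n % d)
  have key : ∀ {κ : Type _} [Fintype κ] (g : κ → ℤ), Fintype.card κ = d →
      (∀ i j, (d : ℤ) ∣ g i - g j → i = j) →
      ∑ i, f (g i) = ∑ x : ZMod d, f (x.val : ℤ) := by
    intro κ _ g hc hi
    refine Fintype.sum_bijective (fun i => ((g i : ℤ) : ZMod d)) ?_ _ _ fun i => hF (g i)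
    rw [Fintype.bijective_iff_injective_and_card]
    refine ⟨fun i j hij => hi i j ?_, by rw [hc, ZMod.card]⟩
    rw [← ZMod.intCast_zmod_eq_zero_iff_dvd]
    simpa [sub_eq_zero] using hij
  rw [key g hcard hinj]
  refine (Fintype.sum_bijective (fun r : Fin d => ((r : ℕ) : ZMod d)) ?_ _ _ fun r => ?_).symm
  · rw [Fintype.bijective_iff_injective_and_card]
    refine ⟨fun i j hij => ?_, by simp [ZMod.card]⟩
    have := (ZMod.natCast_eq_natCast_iff' _ _ _).1 hij
    rw [Nat.mod_eq_of_lt i.2, Nat.mod_eq_of_lt j.2] at this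
    exact Fin.ext this
  · rw [ZMod.val_natCast, Nat.mod_eq_of_lt r.2]

/-- The quadratic Gauss sum `∑ exp (2 π i x r ^ 2 / d)` over `r` modulo `d`. -/
noncomputable def quadGauss (x : ℤ) (d : ℕ) : ℂ :=
  ∑ r : Fin d, Complex.exp (2 * Real.pi * Complex.I * (x * (((r : ℕ) : ℤ) : ℂ) ^ 2 / d))

/-- Two complex numbers that differ by an integer have the same image under `exp (2 π i ·)`. -/
lemma exp_two_pi_mul_eq {z w : ℂ} (n : ℤ) (h : z = w + n) :
    Complex.exp (2 * Real.pi * Complex.I * z) = Complex.exp (2 * Real.pi * Complex.I * w) := by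
  rw [Complex.exp_eq_exp_iff_exists_int]
  exact ⟨n, by rw [h]; ring⟩

lemma quadGauss_eq_sum {ι : Type*} [Fintype ι] (x : ℤ) {d : ℕ} [NeZero d] (g : ι → ℤ)
    (hcard : Fintype.card ι = d) (hinj : ∀ i j, (d : ℤ) ∣ g i - g j → i = j) :
    quadGauss x d =
      ∑ i, Complex.exp (2 * Real.pi * Complex.I * (x * ((g i : ℤ) : ℂ) ^ 2 / d)) := by
  have hd : (d : ℂ) ≠ 0 := NeZero.ne _
  refine (sum_residueSystem (f := fun n : ℤ =>
    Complex.exp (2 * Real.pi * Complex.I * (x * (n : ℂ) ^ 2 / d))) (fun n => ?_) g hcard hinj).symm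
  refine exp_two_pi_mul_eq (2 * x * n + x * d) ?_
  push_cast
  field_simp
  ring

lemma Fin.eq_of_dvd_sub {k : ℕ} {i j : Fin k} (h : (k : ℤ) ∣ ((i : ℕ) : ℤ) - ((j : ℕ) : ℤ)) :
    i = j := by
  have := Int.eq_zero_of_abs_lt_dvd h (by rw [abs_lt]; constructor <;> omega)
  exact Fin.ext (by omega)

/-- Twisted multiplicativity of Gauss sums, from the residues `n s + m t` modulo `m n`. -/
lemma quadGauss_mul (x : ℤ) {m n : ℕ} [NeZero m] [NeZero n] (h : m.Coprime n) :
    quadGauss x (m * n) = quadGauss (x * n) m * quadGauss (x * m) n := by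
  have hm : (m : ℂ) ≠ 0 := NeZero.ne _
  have hn : (n : ℂ) ≠ 0 := NeZero.ne _
  have hmn : IsCoprime (m : ℤ) n := Nat.isCoprime_iff_coprime.2 h
  rw [quadGauss_eq_sum x
    (fun i : Fin m × Fin n => (n : ℤ) * ((i.1 : ℕ) : ℤ) + m * ((i.2 : ℕ) : ℤ)) (by simp)]
  · rw [quadGauss, quadGauss, Finset.sum_mul_sum, Fintype.sum_prod_type]
    refine Finset.sum_congr rfl fun s _ => Finset.sum_congr rfl fun t _ => ?_
    rw [← Complex.exp_add, ← mul_add]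
    refine exp_two_pi_mul_eq (2 * x * (s : ℕ) * (t : ℕ)) ?_
    push_cast
    field_simp
    ring
  · rintro ⟨s, t⟩ ⟨s', t'⟩ hd
    push_cast at hd
    refine Prod.ext (Fin.eq_of_dvd_sub (hmn.dvd_of_dvd_mul_left ?_))
      (Fin.eq_of_dvd_sub (hmn.symm.dvd_of_dvd_mul_left ?_))
    · have h1 := (Dvd.intro _ rfl : (m : ℤ) ∣ m * n).trans hd
      have h2 : (m : ℤ) ∣ m * (((t : ℕ) : ℤ) - ((t' : ℕ) : ℤ)) := Dvd.intro _ rfl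
      convert dvd_sub h1 h2 using 1
      ring
    · have h1 := (Dvd.intro_left _ rfl : (n : ℤ) ∣ m * n).trans hd
      have h2 : (n : ℤ) ∣ n * (((s : ℕ) : ℤ) - ((s' : ℕ) : ℤ)) := Dvd.intro _ rfl
      convert dvd_sub h1 h2 using 1
      ring

lemma sum_exp_mul_div_eq_zero {y : ℤ} {p : ℕ} [NeZero p] (hy : ¬ (p : ℤ) ∣ y) :
    ∑ t : Fin p, Complex.exp (2 * Real.pi * Complex.I * (y * (t : ℕ) / p)) = 0 := by
  have hp : (p : ℂ) ≠ 0 := NeZero.ne _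
  have h2 : (2 * Real.pi * Complex.I : ℂ) ≠ 0 := Complex.two_pi_I_ne_zero
  set ζ := Complex.exp (2 * Real.pi * Complex.I * (y / p)) with hζ
  have h1 : ζ ≠ 1 := by
    rw [hζ, Ne, Complex.exp_eq_one_iff]
    rintro ⟨n, hn⟩
    rw [mul_comm (n : ℂ)] at hn
    have := mul_left_cancel₀ h2 hn
    rw [div_eq_iff hp] at this
    exact hy ⟨n, by rw [mul_comm]; exact_mod_cast this⟩
  have h3 : ζ ^ p = 1 := by
    rw [hζ, ← Complex.exp_nat_mul, Complex.exp_eq_one_iff]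
    exact ⟨y, by field_simp⟩
  calc _ = ∑ t : Fin p, ζ ^ (t : ℕ) := Finset.sum_congr rfl fun t _ => by
        rw [hζ, ← Complex.exp_nat_mul]
        congr 1
        ring
    _ = 0 := by
        rw [Fin.sum_univ_eq_sum_range (fun t => ζ ^ t) p, geom_sum_eq h1, h3, sub_self, zero_div]

/-- The square of a prime divides out of the modulus: in the residues `p u + r + p e t` modulo
`p ^ 2 e`, the sum over `t` vanishes unless `r = 0`. -/
lemma quadGauss_sq_mul {x : ℤ} {p e : ℕ} (hp : p.Prime) [NeZero e] (hx : ¬ (p : ℤ) ∣ 2 * x) :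
    quadGauss x (p * p * e) = p * quadGauss x e := by
  have : NeZero p := ⟨hp.ne_zero⟩
  have hpz : (p : ℤ) ≠ 0 := NeZero.ne _
  have hp0 : (p : ℂ) ≠ 0 := NeZero.ne _
  have he : (e : ℂ) ≠ 0 := NeZero.ne _
  have hez : (e : ℤ) ≠ 0 := NeZero.ne _
  rw [quadGauss_eq_sum x (fun i : Fin e × Fin p × Fin p =>
    (p : ℤ) * ((i.1 : ℕ) : ℤ) + ((i.2.1 : ℕ) : ℤ) + p * e * ((i.2.2 : ℕ) : ℤ))
    (by simp; ring)]
  · rw [quadGauss, Finset.mul_sum, Fintype.sum_prod_type]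
    refine Finset.sum_congr rfl fun u _ => ?_
    rw [Fintype.sum_prod_type]
    have hterm : ∀ r t : Fin p, Complex.exp (2 * Real.pi * Complex.I *
        (x * (((p : ℤ) * ((u : ℕ) : ℤ) + ((r : ℕ) : ℤ) + p * e * ((t : ℕ) : ℤ) : ℤ) : ℂ) ^ 2 /
          ((p * p * e : ℕ) : ℂ))) =
        Complex.exp (2 * Real.pi * Complex.I *
          (x * (p * (u : ℕ) + (r : ℕ)) ^ 2 / (p * p * e))) *
        Complex.exp (2 * Real.pi * Complex.I * (((2 * x * (r : ℕ) : ℤ) : ℂ) * (t : ℕ) / p)) := by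
      intro r t
      rw [← Complex.exp_add, ← mul_add]
      refine exp_two_pi_mul_eq (2 * x * (u : ℕ) * (t : ℕ) + x * e * (t : ℕ) ^ 2) ?_
      push_cast
      field_simp
      ring
    simp only [hterm, ← Finset.mul_sum]
    rw [Finset.sum_eq_single (0 : Fin p)]
    · have : ∀ t : Fin p, Complex.exp (2 * Real.pi * Complex.I *
          (((2 * x * ((0 : Fin p) : ℕ) : ℤ) : ℂ) * (t : ℕ) / p)) = 1 := fun t => by simp
      simp only [this, Finset.sum_const, Finset.card_univ, Fintype.card_fin, nsmul_eq_mul, mul_one]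
      rw [mul_comm]
      congr 3
      simp
      field_simp
    · intro r _ hr
      rw [sum_exp_mul_div_eq_zero, mul_zero]
      intro h
      rcases (Nat.prime_iff_prime_int.1 hp).dvd_or_dvd h with h | h
      · exact hx h
      · exact hr (Fin.eq_of_dvd_sub (by simpa using h))
    · simp
  · rintro ⟨u, r, t⟩ ⟨u', r', t'⟩ hd
    push_cast at hd
    obtain ⟨z, hz⟩ := hd
    have hr : r = r' := Fin.eq_of_dvd_sub
      ⟨p * e * z - (((u : ℕ) : ℤ) - ((u' : ℕ) : ℤ)) - e * (((t : ℕ) : ℤ) - ((t' : ℕ) : ℤ)),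
        by linear_combination hz⟩
    subst hr
    have hz' : (((u : ℕ) : ℤ) - ((u' : ℕ) : ℤ)) + e * (((t : ℕ) : ℤ) - ((t' : ℕ) : ℤ)) =
        p * e * z := mul_left_cancel₀ hpz (by linear_combination hz)
    have hu : u = u' := Fin.eq_of_dvd_sub
      ⟨p * z - (((t : ℕ) : ℤ) - ((t' : ℕ) : ℤ)), by linear_combination hz'⟩
    subst hu
    have ht : t = t' := Fin.eq_of_dvd_sub
      ⟨z, mul_left_cancel₀ hez (by linear_combination hz')⟩
    rw [ht]

lemma quadGauss_eq_sum_stdAddChar (x : ℤ) (p : ℕ) [NeZero p] :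
    quadGauss x p = ∑ r : ZMod p, ZMod.stdAddChar ((x : ZMod p) * r ^ 2) := by
  rw [quadGauss_eq_sum x (fun r : ZMod p => (r.val : ℤ)) (ZMod.card p)]
  · refine Finset.sum_congr rfl fun r _ => ?_
    have h : (x : ZMod p) * r ^ 2 = ((x * (r.val : ℤ) ^ 2 : ℤ) : ZMod p) := by simp
    rw [h, ZMod.stdAddChar_coe]
    congr 1
    push_cast
    ring
  · intro i j h
    rw [← ZMod.intCast_zmod_eq_zero_iff_dvd] at h
    simpa [sub_eq_zero] using h

/-- To a prime modulus, `r ^ 2` takes the value `a` exactly `1 + (a / p)` times. -/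
lemma quadGauss_prime {p : ℕ} [Fact p.Prime] (hp : p ≠ 2) {x : ℤ} (hx : (x : ZMod p) ≠ 0) :
    quadGauss x p = J(x | p) * gaussSum ((quadraticChar (ZMod p)).ringHomComp (Int.castRingHom ℂ))
      (ZMod.stdAddChar (N := p)) := by
  set χ := (quadraticChar (ZMod p)).ringHomComp (Int.castRingHom ℂ) with hχ
  have hchar : ringChar (ZMod p) ≠ 2 := by rwa [ZMod.ringChar_zmod_n]
  have hJ : (J(x | p) : ℂ) = χ x := by
    rw [← jacobiSym.legendreSym.to_jacobiSym, legendreSym]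
    simp [hχ]
  have hsq : χ x * χ x = 1 := by
    have := quadraticChar_sq_one (F := ZMod p) hx
    rw [← pow_two, hχ, MulChar.ringHomComp_apply, ← map_pow, this, map_one]
  have hsum : ∑ a : ZMod p, ZMod.stdAddChar ((x : ZMod p) * a) = 0 := by
    have := AddChar.sum_mulShift (x : ZMod p) (ZMod.isPrimitive_stdAddChar p)
    simp only [hx, if_false, Nat.cast_zero] at this
    simpa [mul_comm] using this
  rw [quadGauss_eq_sum_stdAddChar]
  calc ∑ r : ZMod p, ZMod.stdAddChar ((x : ZMod p) * r ^ 2)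
      = ∑ a : ZMod p, ∑ r with r ^ 2 = a, ZMod.stdAddChar ((x : ZMod p) * r ^ 2) :=
        (Finset.sum_fiberwise _ _ _).symm
    _ = ∑ a : ZMod p, (χ a + 1) * ZMod.stdAddChar ((x : ZMod p) * a) := by
        refine Finset.sum_congr rfl fun a _ => ?_
        rw [Finset.sum_congr rfl (g := fun _ => ZMod.stdAddChar ((x : ZMod p) * a))
          (by intro r hr; rw [(Finset.mem_filter.1 hr).2]), Finset.sum_const, nsmul_eq_mul]
        congr 1
        have := quadraticChar_card_sqrts hchar a
        have h2 : (Finset.univ.filter fun r : ZMod p => r ^ 2 = a) =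
            {r : ZMod p | r ^ 2 = a}.toFinset := by ext; simp
        rw [h2]
        rw [hχ, MulChar.ringHomComp_apply, eq_intCast]
        exact_mod_cast congrArg (Int.cast : ℤ → ℂ) this
    _ = ∑ a : ZMod p, χ a * ZMod.stdAddChar ((x : ZMod p) * a) := by
        simp only [add_mul, one_mul, Finset.sum_add_distrib, hsum, add_zero]
    _ = gaussSum χ (AddChar.mulShift ZMod.stdAddChar (x : ZMod p)) := rfl
    _ = _ := by
        have := gaussSum_mulShift χ (ZMod.stdAddChar (N := p)) (Units.mk0 _ hx)
        rw [← this, Units.val_mk0, hJ, ← mul_assoc, hsq, one_mul]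

lemma isCoprime_natCast_of_dvd {x : ℤ} {d e : ℕ} (h : IsCoprime x d) (he : e ∣ d) :
    IsCoprime x e :=
  h.of_isCoprime_of_dvd_right (Int.natCast_dvd_natCast.2 he)

lemma jacobiSym_sq_cast {x : ℤ} {d : ℕ} (h : IsCoprime x d) : (J(x | d) : ℂ) ^ 2 = 1 := by
  exact_mod_cast congrArg (Int.cast : ℤ → ℂ) (jacobiSym.sq_one (Int.isCoprime_iff_gcd_eq_one.1 h))

/-- The dependence of Gauss sums to an odd modulus `d` on the numerator, and their size up to
sign. Only `G ^ 2` is needed, so the sign of the Gauss sum plays no role. -/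
lemma quadGauss_eq_jacobiSym_mul_and_sq (d : ℕ) (hd : Odd d) :
    quadGauss 1 d ^ 2 = J(-1 | d) * d ∧
      ∀ x : ℤ, IsCoprime x d → quadGauss x d = J(x | d) * quadGauss 1 d := by
  induction d using Nat.strong_induction_on with
  | _ d ih =>
    rcases eq_or_ne d 1 with rfl | hd1
    · simp [quadGauss]
    have hp : d.minFac.Prime := Nat.minFac_prime hd1
    set p := d.minFac with hpdef
    have : Fact p.Prime := ⟨hp⟩
    have : NeZero p := ⟨hp.ne_zero⟩
    obtain ⟨e, he⟩ : p ∣ d := Nat.minFac_dvd d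
    have hpodd : Odd p := (Nat.odd_mul.1 (he ▸ hd)).1
    have heodd : Odd e := (Nat.odd_mul.1 (he ▸ hd)).2
    have hp2 : p ≠ 2 := by rintro h; rw [h] at hpodd; exact absurd hpodd (by decide)
    have : NeZero e := ⟨heodd.pos.ne'⟩
    have hlt : e < d := by
      rw [he]; exact lt_mul_of_one_lt_left heodd.pos hp.one_lt
    have hpx : ∀ {x : ℤ}, IsCoprime x p → ¬ (p : ℤ) ∣ x := fun hx h =>
      (Nat.prime_iff_prime_int.1 hp).not_isUnit (hx.symm.isUnit_of_dvd' dvd_rfl h)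
    have h1 : ∀ n : ℤ, IsCoprime (1 : ℤ) n := fun n => isCoprime_one_left
    have hm1 : ∀ n : ℤ, IsCoprime (-1 : ℤ) n := fun n => (h1 n).neg_left
    by_cases hpe : p ∣ e
    · obtain ⟨e', rfl⟩ := hpe
      have he'odd : Odd e' := (Nat.odd_mul.1 heodd).2
      have : NeZero e' := ⟨he'odd.pos.ne'⟩
      obtain ⟨i1, i2⟩ := ih e' (lt_of_le_of_lt
        (Nat.le_mul_of_pos_left e' hp.pos) hlt) he'odd
      rw [← mul_assoc] at he
      have hred : ∀ {x : ℤ}, IsCoprime x d →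
          quadGauss x d = p * quadGauss x e' ∧ J(x | d) = J(x | e') := by
        intro x hx
        have hxp : IsCoprime x p := isCoprime_natCast_of_dvd hx ⟨p * e', by rw [he]; ring⟩
        refine ⟨?_, ?_⟩
        · rw [he]
          refine quadGauss_sq_mul hp fun h => ?_
          rcases (Nat.prime_iff_prime_int.1 hp).dvd_or_dvd h with h | h
          · exact hp2 ((Nat.prime_dvd_prime_iff_eq hp Nat.prime_two).1 (by exact_mod_cast h))
          · exact hpx hxp h
        · rw [he, jacobiSym.mul_right, jacobiSym.mul_right, ← pow_two,
            jacobiSym.sq_one (Int.isCoprime_iff_gcd_eq_one.1 hxp), one_mul]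
      refine ⟨?_, fun x hx => ?_⟩
      · rw [(hred (h1 _)).1, (hred (hm1 _)).2, mul_pow, i1, he]
        push_cast
        ring
      · rw [(hred hx).1, (hred (h1 _)).1, (hred hx).2,
          i2 x (isCoprime_natCast_of_dvd hx ⟨p * p, by rw [he]; ring⟩)]
        ring
    · have hcop : p.Coprime e := (Nat.Prime.coprime_iff_not_dvd hp).2 hpe
      have hcz : IsCoprime (p : ℤ) e := Nat.isCoprime_iff_coprime.2 hcop
      obtain ⟨i1, i2⟩ := ih e hlt heodd
      have hpr : ∀ {x : ℤ}, IsCoprime x p → quadGauss x p =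
          J(x | p) * gaussSum ((quadraticChar (ZMod p)).ringHomComp (Int.castRingHom ℂ))
            (ZMod.stdAddChar (N := p)) := fun hx =>
        quadGauss_prime hp2 fun h => hpx hx ((ZMod.intCast_zmod_eq_zero_iff_dvd _ _).1 h)
      set g := gaussSum ((quadraticChar (ZMod p)).ringHomComp (Int.castRingHom ℂ))
        (ZMod.stdAddChar (N := p)) with hg
      have hgsq : g ^ 2 = J(-1 | p) * p := by
        have hchar : ringChar (ZMod p) ≠ 2 := by rwa [ZMod.ringChar_zmod_n]
        rw [hg, gaussSum_sq ?_ ?_ (ZMod.isPrimitive_stdAddChar p), ZMod.card,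
          ← jacobiSym.legendreSym.to_jacobiSym, legendreSym]
        · simp
        · rw [MulChar.ringHomComp_ne_one_iff (RingHom.injective_int _)]
          exact quadraticChar_ne_one hchar
        · exact (quadraticChar_isQuadratic _).comp _
      have hform : ∀ {x : ℤ}, IsCoprime x d → quadGauss x d =
          J(x | d) * (J(e | p) * J(p | e) * g * quadGauss 1 e) := by
        intro x hx
        have hxp : IsCoprime x p := isCoprime_natCast_of_dvd hx ⟨e, he⟩
        have hxe : IsCoprime x e := isCoprime_natCast_of_dvd hx ⟨p, by rw [he]; ring⟩
        rw [he, quadGauss_mul x hcop, hpr (hxp.mul_left hcz.symm), i2 _ (hxe.mul_left hcz),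
          jacobiSym.mul_right, jacobiSym.mul_left, jacobiSym.mul_left]
        push_cast
        ring
      refine ⟨?_, fun x hx => ?_⟩
      · rw [hform (h1 _), jacobiSym.one_left]
        have a1 := jacobiSym_sq_cast hcz
        have a2 := jacobiSym_sq_cast hcz.symm
        rw [he, jacobiSym.mul_right]
        push_cast
        calc _ = (J(e | p) : ℂ) ^ 2 * (J(p | e) : ℂ) ^ 2 * g ^ 2 * quadGauss 1 e ^ 2 := by ring
          _ = _ := by rw [a1, a2, hgsq, i1]; ring
      · rw [hform hx, hform (h1 _), jacobiSym.one_left]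
        push_cast
        ring

/-! ### Transformation of theta series with characteristic -/

/-- The theta series `∑ exp (π i (n + ρ) ^ 2 τ)` over all integers `n`, with characteristic
`ρ`. -/
noncomputable def thetaChar (ρ τ : ℂ) : ℂ :=
  ∑' n : ℤ, Complex.exp (Real.pi * Complex.I * ((n : ℂ) + ρ) ^ 2 * τ)

lemma exp_add_sq_eq_jacobiTheta₂_term (ρ τ : ℂ) (n : ℤ) :
    Complex.exp (Real.pi * Complex.I * ((n : ℂ) + ρ) ^ 2 * τ) =
      Complex.exp (Real.pi * Complex.I * ρ ^ 2 * τ) * jacobiTheta₂_term n (ρ * τ) τ := by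
  rw [jacobiTheta₂_term, ← Complex.exp_add]
  congr 1
  ring

lemma thetaChar_eq_mul_jacobiTheta₂ (ρ τ : ℂ) :
    thetaChar ρ τ = Complex.exp (Real.pi * Complex.I * ρ ^ 2 * τ) * jacobiTheta₂ (ρ * τ) τ := by
  simp only [thetaChar, exp_add_sq_eq_jacobiTheta₂_term, tsum_mul_left, jacobiTheta₂]

lemma summable_thetaChar (ρ : ℂ) {τ : ℂ} (hτ : 0 < τ.im) :
    Summable fun n : ℤ => Complex.exp (Real.pi * Complex.I * ((n : ℂ) + ρ) ^ 2 * τ) := by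
  simp only [exp_add_sq_eq_jacobiTheta₂_term]
  exact ((summable_jacobiTheta₂_term_iff _ _).2 hτ).mul_left _

/-- Poisson summation: inversion exchanges the characteristic and the elliptic variable. -/
lemma thetaChar_inversion (ρ : ℂ) {τ : ℂ} (hτ : τ ≠ 0) :
    thetaChar ρ τ = 1 / (-Complex.I * τ) ^ (1 / 2 : ℂ) * jacobiTheta₂ ρ (-1 / τ) := by
  rw [thetaChar_eq_mul_jacobiTheta₂, jacobiTheta₂_functional_equation, mul_div_cancel_right₀ _ hτ]
  have : Complex.exp (Real.pi * Complex.I * ρ ^ 2 * τ) *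
      Complex.exp (-Real.pi * Complex.I * (ρ * τ) ^ 2 / τ) = 1 := by
    rw [← Complex.exp_add, Complex.exp_eq_one_iff]
    exact ⟨0, by field_simp; simp⟩
  linear_combination (1 / (-Complex.I * τ) ^ (1 / 2 : ℂ) * jacobiTheta₂ ρ (-1 / τ)) * this

lemma tsum_int_eq_sum_residue {f : ℤ → ℂ} (hf : Summable f) (d : ℕ) [NeZero d] :
    ∑' n, f n = ∑ r : Fin d, ∑' m : ℤ, f (m * d + (r : ℕ)) := by
  set e := (Equiv.prodComm (Fin d) ℤ).trans (Int.divModEquiv d).symm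
  rw [← e.tsum_eq f]
  change ∑' p, (f ∘ e) p = _
  rw [Summable.tsum_prod ((Equiv.summable_iff e).2 hf), tsum_fintype]
  rfl

/-- The finite exponential sum by which the theta series of characteristic `k / 2` is multiplied
under a transformation with rational part `b / d`. -/
noncomputable def thetaGauss (k b : ℤ) (d : ℕ) : ℂ :=
  ∑ r : Fin d, Complex.exp (2 * Real.pi * Complex.I *
    (b * ((((r : ℕ) : ℤ) : ℂ) + k / 2) ^ 2 / (2 * d)))

/-- Completing the square: the twist by `m` disappears after the shift `r ↦ r + m c`, because
`b c ≡ -1` modulo `d`. -/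
lemma sum_thetaGauss_twist {a b c k : ℤ} {d : ℕ} [NeZero d] (hdet : a * d - b * c = 1)
    (hc : Even c) (hk : Even (b * (k + 1))) (m : ℤ) :
    ∑ r : Fin d, Complex.exp (2 * Real.pi * Complex.I *
      ((b * ((((r : ℕ) : ℤ) : ℂ) + k / 2) ^ 2 + 2 * m * ((((r : ℕ) : ℤ) : ℂ) + k / 2)
        - m ^ 2 * c) / (2 * d))) =
    Complex.exp (2 * Real.pi * Complex.I * (m * (k / 2))) * thetaGauss k b d := by
  have hd : (d : ℂ) ≠ 0 := NeZero.ne _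
  obtain ⟨c', hc'⟩ := hc
  obtain ⟨s, hs⟩ := hk
  have hodd : Odd (a * d) := by
    rw [show a * d = 2 * (b * c') + 1 by rw [hc'] at hdet; linarith]
    exact odd_two_mul_add_one _
  obtain ⟨a', ha'⟩ := (Int.odd_mul.1 hodd).1
  obtain ⟨d', hd'⟩ := (Int.odd_mul.1 hodd).2
  have hdC : (d : ℂ) = 2 * d' + 1 := by exact_mod_cast congrArg (Int.cast : ℤ → ℂ) hd'
  have haC : (a : ℂ) = 2 * a' + 1 := by exact_mod_cast congrArg (Int.cast : ℤ → ℂ) ha'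
  have hcC : (c : ℂ) = c' + c' := by exact_mod_cast congrArg (Int.cast : ℤ → ℂ) hc'
  have hsC : (b : ℂ) * (k + 1) = s + s := by exact_mod_cast congrArg (Int.cast : ℤ → ℂ) hs
  have hdetC : (a : ℂ) * d - b * c = 1 := by exact_mod_cast congrArg (Int.cast : ℤ → ℂ) hdet
  have hshift := sum_residueSystem (d := d) (f := fun n : ℤ =>
      Complex.exp (2 * Real.pi * Complex.I *
      ((b * ((n : ℂ) + k / 2) ^ 2 + 2 * m * ((n : ℂ) + k / 2) - m ^ 2 * c) / (2 * d))))
    (fun n => exp_two_pi_mul_eq (b * n + s + b * d' + m) (by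
      push_cast
      rw [← sub_eq_iff_eq_add']
      field_simp
      linear_combination 4 * (d : ℂ) * hsC + 4 * b * d * hdC))
    (fun r : Fin d => ((r : ℕ) : ℤ) + m * c) (Fintype.card_fin d)
    (fun i j h => Fin.eq_of_dvd_sub (by simpa using h))
  rw [← hshift, thetaGauss, Finset.mul_sum]
  refine Finset.sum_congr rfl fun r _ => ?_
  rw [← Complex.exp_add, ← mul_add]
  refine exp_two_pi_mul_eq (m * a * (r : ℕ) + m * k * a' + m ^ 2 * c' * a) ?_
  push_cast
  rw [← sub_eq_iff_eq_add']
  field_simp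
  linear_combination -4 * (2 * m * ((r : ℕ) + k / 2) + m ^ 2 * c : ℂ) * hdetC +
    4 * m * k * d * haC + 4 * m ^ 2 * a * d * hcC

lemma cast_mul_add_ne_zero {c : ℤ} {d : ℕ} [NeZero d] {τ : ℂ} (hτ : 0 < τ.im) :
    (c * τ + d : ℂ) ≠ 0 := by
  intro h0
  have him := congrArg Complex.im h0
  have hre := congrArg Complex.re h0
  have hc : c = 0 := by simpa [hτ.ne'] using him
  rw [hc] at hre
  exact NeZero.ne d (by simpa using hre)

lemma im_mul_div_pos {c : ℤ} {d : ℕ} [NeZero d] {τ : ℂ} (hτ : 0 < τ.im) :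
    0 < (d * τ / (c * τ + d) : ℂ).im := by
  have hd : (0 : ℝ) < d := Nat.cast_pos.2 (NeZero.pos d)
  have hne := cast_mul_add_ne_zero (c := c) (d := d) hτ
  have hpos : 0 < Complex.normSq (c * τ + d) := Complex.normSq_pos.2 hne
  have : (d * τ / (c * τ + d) : ℂ).im = d ^ 2 * τ.im / Complex.normSq (c * τ + d) := by
    rw [Complex.div_im]
    simp
    field_simp
    ring
  rw [this]
  positivity

/-- The transformation law of theta series with characteristic `0` or `1 / 2`. Splitting the
series along residues modulo `d` and applying Poisson summation to each part turns `b / d + w`,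
the image of `τ`, into `-1 / τ`. -/
lemma thetaChar_smul {a b c k : ℤ} {d : ℕ} [NeZero d] (hdet : a * d - b * c = 1)
    (hc : Even c) (hk : Even (b * (k + 1))) {τ : ℂ} (hτ : 0 < τ.im) :
    thetaChar (k / 2) ((a * τ + b) / (c * τ + d)) =
      thetaGauss k b d * ((-Complex.I * τ) ^ (1 / 2 : ℂ) /
        (-Complex.I * (d * τ / (c * τ + d))) ^ (1 / 2 : ℂ)) * thetaChar (k / 2) τ := by
  have hd : (d : ℂ) ≠ 0 := NeZero.ne _
  have hdpos : (0 : ℝ) < d := Nat.cast_pos.2 (NeZero.pos d)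
  have hτ0 : τ ≠ 0 := by rintro rfl; simp at hτ
  have hdetC : (a : ℂ) * d - b * c = 1 := by exact_mod_cast congrArg (Int.cast : ℤ → ℂ) hdet
  have hne := cast_mul_add_ne_zero (c := c) (d := d) hτ
  set t : ℂ := d * τ / (c * τ + d) with ht
  have htim : 0 < t.im := im_mul_div_pos hτ
  have ht0 : t ≠ 0 := by intro h; rw [h] at htim; simp at htim
  have hγ : (a * τ + b) / (c * τ + d) = b / d + t / d ^ 2 := by
    rw [ht]
    obtain ⟨D, hD⟩ : ∃ D : ℂ, D = c * τ + d := ⟨_, rfl⟩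
    rw [← hD] at hne ⊢
    field_simp
    linear_combination -b * hD + τ * hdetC
  have hγim : 0 < ((a * τ + b) / (c * τ + d) : ℂ).im := by
    have h : (b / d + t / d ^ 2 : ℂ).im = t.im / d ^ 2 := by
      have h1 : (b / d : ℂ) = ((b / d : ℝ) : ℂ) := by push_cast; rfl
      have h2 : (t / d ^ 2 : ℂ) = t / ((d ^ 2 : ℝ) : ℂ) := by push_cast; rfl
      rw [h1, h2, Complex.add_im, Complex.ofReal_im, Complex.div_ofReal_im, zero_add]
    rw [hγ, h]
    positivity
  set A : ℂ := (-Complex.I * t) ^ (1 / 2 : ℂ) with hA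
  set B : ℂ := (-Complex.I * τ) ^ (1 / 2 : ℂ) with hB
  have hB0 : B ≠ 0 := by
    rw [hB, Ne, Complex.cpow_eq_zero_iff]
    simp [hτ0]
  have hinv : -1 / t = -c / d + -1 / τ := by
    rw [ht]
    field_simp
    ring
  -- the part of the series over the residue class of `r`, after Poisson summation
  have hpart : ∀ r : Fin d, ∑' m : ℤ, Complex.exp (Real.pi * Complex.I *
      (((m * d + (r : ℕ) : ℤ) : ℂ) + k / 2) ^ 2 * ((a * τ + b) / (c * τ + d))) =
      1 / A * ∑' m : ℤ, Complex.exp (2 * Real.pi * Complex.I *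
        ((b * ((((r : ℕ) : ℤ) : ℂ) + k / 2) ^ 2 + 2 * m * ((((r : ℕ) : ℤ) : ℂ) + k / 2)
        - m ^ 2 * c) / (2 * d))) * Complex.exp (Real.pi * Complex.I * m ^ 2 * (-1 / τ)) := by
    intro r
    set ρ : ℂ := (((r : ℕ) : ℤ) : ℂ) + k / 2 with hρ
    calc _ = ∑' m : ℤ, Complex.exp (Real.pi * Complex.I * (b * ρ ^ 2 / d)) *
          Complex.exp (Real.pi * Complex.I * ((m : ℂ) + ρ / d) ^ 2 * t) := by
          refine tsum_congr fun m => ?_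
          have hk' : Even (b * (d + k)) := by
            have h1 : Odd (a * (d : ℤ)) := by
              rw [show a * (d : ℤ) = b * c + 1 by linarith]
              exact (hc.mul_left b).add_one
            have h2 : Even (b * ((d : ℤ) - 1)) :=
              ((Int.odd_mul.1 h1).2.sub_odd odd_one).mul_left b
            rw [show b * ((d : ℤ) + k) = b * (k + 1) + b * ((d : ℤ) - 1) by ring]
            exact hk.add h2
          obtain ⟨s, hs⟩ := hk'
          have hsC : (b : ℂ) * (d + k) = s + s := by
            exact_mod_cast congrArg (Int.cast : ℤ → ℂ) hs
          rw [← Complex.exp_add, hγ, Complex.exp_eq_exp_iff_exists_int]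
          obtain ⟨u, hu⟩ := Int.even_mul_succ_self (m - 1)
          have huC : ((m : ℂ) - 1) * (m - 1 + 1) = u + u := by
            exact_mod_cast congrArg (Int.cast : ℤ → ℂ) hu
          refine ⟨b * m * (r : ℕ) + m * s + b * d * u, ?_⟩
          push_cast
          rw [hρ]
          field_simp
          linear_combination 4 * (m : ℂ) * d ^ 2 * hsC + 4 * b * d ^ 3 * huC
      _ = Complex.exp (Real.pi * Complex.I * (b * ρ ^ 2 / d)) * (1 / A *
          ∑' m : ℤ, jacobiTheta₂_term m (ρ / d) (-1 / t)) := by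
          rw [tsum_mul_left]
          congr 1
          exact thetaChar_inversion (ρ / d) ht0
      _ = _ := by
          rw [mul_left_comm, ← tsum_mul_left]
          congr 1
          refine tsum_congr fun m => ?_
          rw [jacobiTheta₂_term, ← Complex.exp_add, ← Complex.exp_add, hinv]
          congr 1
          field_simp
          ring
  have hsum : ∀ r : Fin d, Summable fun m : ℤ => Complex.exp (2 * Real.pi * Complex.I *
        ((b * ((((r : ℕ) : ℤ) : ℂ) + k / 2) ^ 2 + 2 * m * ((((r : ℕ) : ℤ) : ℂ) + k / 2)
        - m ^ 2 * c) / (2 * d))) * Complex.exp (Real.pi * Complex.I * m ^ 2 * (-1 / τ)) := by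
    intro r
    set ρ : ℂ := (((r : ℕ) : ℤ) : ℂ) + k / 2 with hρ
    have htim' : 0 < (-1 / t).im := by
      rw [neg_div, one_div, Complex.neg_im, Complex.inv_im, neg_div, neg_neg]
      exact div_pos htim (Complex.normSq_pos.2 ht0)
    have h := ((summable_jacobiTheta₂_term_iff (ρ / d) (-1 / t)).2 htim').mul_left
      (Complex.exp (Real.pi * Complex.I * (b * ρ ^ 2 / d)))
    refine h.congr fun m => ?_
    rw [jacobiTheta₂_term, ← Complex.exp_add, ← Complex.exp_add, hinv]
    congr 1
    field_simp
    ring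
  rw [thetaChar, tsum_int_eq_sum_residue (summable_thetaChar _ hγim) d]
  simp only [hpart]
  rw [← Finset.mul_sum, ← Summable.tsum_finsetSum fun r _ => hsum r]
  simp only [← Finset.sum_mul, sum_thetaGauss_twist hdet hc hk]
  rw [thetaChar_inversion _ hτ0, ← hB]
  have hfin : ∑' m : ℤ, Complex.exp (2 * Real.pi * Complex.I * (m * (k / 2))) *
      thetaGauss k b d * Complex.exp (Real.pi * Complex.I * m ^ 2 * (-1 / τ)) =
      thetaGauss k b d * jacobiTheta₂ (k / 2) (-1 / τ) := by
    rw [jacobiTheta₂, ← tsum_mul_left]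
    refine tsum_congr fun m => ?_
    rw [jacobiTheta₂_term, mul_right_comm, ← Complex.exp_add, mul_comm]
    congr 2
    ring
  rw [hfin]
  field_simp

/-! ### The finite exponential sums as Gauss sums -/

lemma thetaGauss_zero (b : ℤ) (d : ℕ) : thetaGauss 0 (2 * b) d = quadGauss b d := by
  refine Finset.sum_congr rfl fun r _ => ?_
  congr 2
  push_cast
  rw [zero_div, add_zero, mul_assoc (2 : ℂ), mul_div_mul_left _ _ two_ne_zero]

/-- For odd `d` the half-integers modulo `d` are represented by `2 r + d / 2`. -/
lemma thetaGauss_one (b : ℤ) {d : ℕ} (hd : Odd d) :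
    thetaGauss 1 b d =
      Complex.exp (2 * Real.pi * Complex.I * (b * d / 8)) * quadGauss (2 * b) d := by
  have : NeZero d := ⟨hd.pos.ne'⟩
  have hd0 : (d : ℂ) ≠ 0 := NeZero.ne _
  obtain ⟨e, he⟩ := hd
  have heC : (d : ℂ) = 2 * e + 1 := by exact_mod_cast congrArg (Nat.cast : ℕ → ℂ) he
  have hcop : IsCoprime (d : ℤ) 2 := ⟨1, -e, by rw [he]; push_cast; ring⟩
  have h := sum_residueSystem (d := d) (f := fun n : ℤ => Complex.exp (2 * Real.pi * Complex.I *
    (b * ((n : ℂ) + (1 : ℤ) / 2) ^ 2 / (2 * d))))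
    (fun n => exp_two_pi_mul_eq (b * n + b * (e + 1)) (by
      push_cast
      rw [← sub_eq_iff_eq_add']
      field_simp
      linear_combination 4 * (b : ℂ) * d * heC))
    (fun r : Fin d => 2 * ((r : ℕ) : ℤ) + e) (Fintype.card_fin d)
    (fun i j h => Fin.eq_of_dvd_sub (hcop.dvd_of_dvd_mul_left
      (by simpa [mul_sub] using h)))
  rw [thetaGauss, ← h, quadGauss, Finset.mul_sum]
  refine Finset.sum_congr rfl fun r _ => ?_
  rw [← Complex.exp_add, ← mul_add]
  refine exp_two_pi_mul_eq (b * (r : ℕ)) ?_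
  push_cast
  rw [heC]
  have : (2 * e + 1 : ℂ) ≠ 0 := heC ▸ hd0
  field_simp
  ring

/-! ### The generating functions as theta series -/

lemma squareTheta_eq_thetaChar (z : ℂ) : squareTheta z = thetaChar ((0 : ℤ) / 2) (2 * z) := by
  refine tsum_congr fun n => ?_
  congr 1
  push_cast
  ring

lemma squareTheta_eq_jacobiTheta (z : ℂ) : squareTheta z = jacobiTheta (2 * z) := by
  refine tsum_congr fun n => ?_
  congr 1
  ring

/-- The function `q ^ (1 / 8) Ψ`, with the normalisation that makes it modular. -/
noncomputable def shiftedPsi (z : ℂ) : ℂ :=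
  Complex.exp (2 * Real.pi * Complex.I * z / 8) * triangularPsi z

/-- The terms `n` and `-1 - n` of the series with characteristic `1 / 2` agree. -/
lemma thetaChar_one_half {z : ℂ} (hz : 0 < z.im) :
    thetaChar ((1 : ℤ) / 2) z = 2 * shiftedPsi z := by
  have hs := summable_thetaChar ((1 : ℤ) / 2) hz
  have hpos : ∀ n : ℕ, Complex.exp (Real.pi * Complex.I * (((n : ℤ) : ℂ) + (1 : ℤ) / 2) ^ 2 * z) =
      Complex.exp (2 * Real.pi * Complex.I * z / 8) *
        Complex.exp (2 * Real.pi * Complex.I * ((n : ℂ) * ((n : ℂ) + 1) / 2) * z) := by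
    intro n
    rw [← Complex.exp_add]
    congr 1
    push_cast
    ring
  have hneg : ∀ n : ℕ, Complex.exp
      (Real.pi * Complex.I * (((-(n + 1 : ℕ) : ℤ) : ℂ) + (1 : ℤ) / 2) ^ 2 * z) =
      Complex.exp (Real.pi * Complex.I * (((n : ℤ) : ℂ) + (1 : ℤ) / 2) ^ 2 * z) := by
    intro n
    congr 1
    push_cast
    ring
  have h1 : Summable fun n : ℕ =>
      Complex.exp (Real.pi * Complex.I * (((n : ℤ) : ℂ) + (1 : ℤ) / 2) ^ 2 * z) :=
    hs.comp_injective Nat.cast_injective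
  have h2 : Summable fun n : ℕ => Complex.exp
      (Real.pi * Complex.I * (((-(n + 1 : ℕ) : ℤ) : ℂ) + (1 : ℤ) / 2) ^ 2 * z) := by
    simpa only [hneg] using h1
  rw [thetaChar, tsum_of_nat_of_neg_add_one h1 (by exact_mod_cast h2)]
  have h3 : ∑' n : ℕ, Complex.exp
      (Real.pi * Complex.I * (((-((n : ℤ) + 1) : ℤ) : ℂ) + (1 : ℤ) / 2) ^ 2 * z) =
      ∑' n : ℕ, Complex.exp (Real.pi * Complex.I * (((n : ℤ) : ℂ) + (1 : ℤ) / 2) ^ 2 * z) :=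
    tsum_congr fun n => by exact_mod_cast hneg n
  rw [h3, ← two_mul]
  simp only [hpos, tsum_mul_left]
  rfl

/-- The odd squares are the squares without the even ones. -/
lemma two_mul_shiftedPsi {z : ℂ} (hz : 0 < z.im) :
    2 * shiftedPsi z = squareTheta (z / 8) - squareTheta (z / 2) := by
  have hz4 : 0 < (z / 4).im := by
    have : (z / 4).im = z.im / 4 := by
      simp
    rw [this]; positivity
  have h := tsum_int_eq_sum_residue (summable_thetaChar 0 hz4) 2
  rw [Fin.sum_univ_two] at h
  rw [eq_sub_iff_add_eq, ← thetaChar_one_half hz]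
  calc _ = ∑' m : ℤ, Complex.exp (Real.pi * Complex.I *
          (((m * (2 : ℕ) + ((1 : Fin 2) : ℕ) : ℤ) : ℂ) + 0) ^ 2 * (z / 4)) +
        ∑' m : ℤ, Complex.exp (Real.pi * Complex.I *
          (((m * (2 : ℕ) + ((0 : Fin 2) : ℕ) : ℤ) : ℂ) + 0) ^ 2 * (z / 4)) := by
        congr 1 <;>
        · refine tsum_congr fun m => ?_
          congr 1
          push_cast
          simp
          ring
    _ = _ := by
        rw [add_comm, ← h]
        refine tsum_congr fun m => ?_
        congr 1
        ring

lemma exp_mul_mixedGen {v k : ℕ} (b : Fin v → ℕ) (c : Fin k → ℕ) (τ : ℍ) :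
    Complex.exp (2 * Real.pi * Complex.I * ((∑ j, c j : ℕ) : ℂ) / 8 * (τ : ℂ)) *
      mixedGen b c τ = (∏ i, squareTheta (b i * τ)) * ∏ j, shiftedPsi (c j * τ) := by
  simp only [mixedGen, shiftedPsi, Finset.prod_mul_distrib, ← Complex.exp_sum]
  rw [mul_left_comm]
  congr 3
  rw [← Finset.sum_div, ← Finset.mul_sum, ← Finset.sum_mul]
  push_cast
  ring

/-! ### Transformation of the generating functions -/

/-- The ratio of principal square roots in the transformation law; its square is
`(c τ + d) / d`. -/
noncomputable def sqrtRatio (c : ℤ) (d : ℕ) (τ : ℂ) : ℂ :=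
  (-Complex.I * τ) ^ (1 / 2 : ℂ) / (-Complex.I * (d * τ / (c * τ + d))) ^ (1 / 2 : ℂ)

lemma ofReal_mul_cpow {s : ℝ} (hs : 0 < s) (z r : ℂ) :
    ((s : ℂ) * z) ^ r = (s : ℂ) ^ r * z ^ r := by
  rcases eq_or_ne z 0 with rfl | hz
  · rcases eq_or_ne r 0 with rfl | hr
    · simp
    · simp [Complex.zero_cpow hr]
  have hs' : (s : ℂ) ≠ 0 := Complex.ofReal_ne_zero.2 hs.ne'
  rw [Complex.cpow_def_of_ne_zero (mul_ne_zero hs' hz), Complex.cpow_def_of_ne_zero hs',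
    Complex.cpow_def_of_ne_zero hz, Complex.log_ofReal_mul hs hz, Complex.ofReal_log hs.le,
    add_mul, Complex.exp_add]

lemma sqrtRatio_scale {s : ℝ} (hs : 0 < s) {c c' : ℤ} {d : ℕ} {τ : ℂ} (hc : (c : ℂ) = s * c') :
    sqrtRatio c' d (s * τ) = sqrtRatio c d τ := by
  have hs' : (s : ℂ) ^ (1 / 2 : ℂ) ≠ 0 := by
    rw [Ne, Complex.cpow_eq_zero_iff]; simp [hs.ne']
  rw [sqrtRatio, show -Complex.I * (s * τ) = s * (-Complex.I * τ) by ring,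
    show -Complex.I * (d * (s * τ) / (c' * (s * τ) + d)) =
      s * (-Complex.I * (d * τ / (c * τ + d))) by rw [hc]; ring,
    ofReal_mul_cpow hs, ofReal_mul_cpow hs, mul_div_mul_left _ _ hs', sqrtRatio]

lemma sqrtRatio_sq {c : ℤ} {d : ℕ} [NeZero d] {τ : ℂ} (hτ : 0 < τ.im) :
    sqrtRatio c d τ ^ 2 = (c * τ + d) / d := by
  have hτ0 : τ ≠ 0 := by rintro rfl; simp at hτ
  have hne := cast_mul_add_ne_zero (c := c) (d := d) hτ
  have hd : (d : ℂ) ≠ 0 := NeZero.ne _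
  have h : ∀ z : ℂ, (z ^ (1 / 2 : ℂ)) ^ 2 = z := fun z => by
    rw [one_div]
    exact Complex.cpow_nat_inv_pow z two_ne_zero
  rw [sqrtRatio, div_pow, h, h]
  have hI := Complex.I_ne_zero
  field_simp

lemma squareTheta_smul {a b c : ℤ} {d s : ℕ} [NeZero d] (hs : 0 < s) (hdet : a * d - b * c = 1)
    (hc : ((4 * s : ℕ) : ℤ) ∣ c) {τ : ℂ} (hτ : 0 < τ.im) :
    squareTheta (s * ((a * τ + b) / (c * τ + d))) =
      quadGauss (s * b) d * sqrtRatio c d τ * squareTheta (s * τ) := by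
  obtain ⟨c', rfl⟩ := hc
  have hsR : (0 : ℝ) < 2 * s := by positivity
  have him : 0 < (2 * (s * τ) : ℂ).im := by
    have : (2 * (s * τ) : ℂ).im = 2 * s * τ.im := by simp; ring
    rw [this]; positivity
  have h := thetaChar_smul (a := a) (b := 2 * (s * b)) (c := 2 * c') (k := 0) (d := d)
    (by rw [← hdet]; push_cast; ring) (even_two_mul _) (by simp) him
  have hR : sqrtRatio (2 * c') d (2 * (s * τ)) = sqrtRatio ((4 * s : ℕ) * c') d τ := by
    rw [← sqrtRatio_scale hsR (c := (4 * s : ℕ) * c') (c' := 2 * c') (by push_cast; ring)]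
    congr 1
    push_cast
    ring
  rw [sqrtRatio] at hR
  rw [hR, thetaGauss_zero, ← squareTheta_eq_thetaChar] at h
  rw [squareTheta_eq_thetaChar, ← h]
  congr 1
  push_cast
  ring

lemma shiftedPsi_smul {a b c : ℤ} {d s : ℕ} [NeZero d] (hs : 0 < s) (hdet : a * d - b * c = 1)
    (hc : ((2 * s : ℕ) : ℤ) ∣ c) (hd : Odd d) {τ : ℂ} (hτ : 0 < τ.im)
    (hγτ : 0 < ((a * τ + b) / (c * τ + d) : ℂ).im) :
    shiftedPsi (s * ((a * τ + b) / (c * τ + d))) =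
      Complex.exp (2 * Real.pi * Complex.I * (s * b * d / 8)) * quadGauss (2 * (s * b)) d *
        sqrtRatio c d τ * shiftedPsi (s * τ) := by
  obtain ⟨c', rfl⟩ := hc
  have hsR : (0 : ℝ) < s := by positivity
  have him : 0 < (s * τ : ℂ).im := by
    have : (s * τ : ℂ).im = s * τ.im := by simp
    rw [this]; positivity
  have him' : 0 < (s * ((a * τ + b) / (((2 * s : ℕ) * c' : ℤ) * τ + d)) : ℂ).im := by
    rw [← Complex.ofReal_natCast s, Complex.im_ofReal_mul]; positivity
  have h := thetaChar_smul (a := a) (b := s * b) (c := 2 * c') (k := 1) (d := d)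
    (by rw [← hdet]; push_cast; ring) (even_two_mul _) ⟨s * b, by ring⟩ him
  have hR : sqrtRatio (2 * c') d (s * τ) = sqrtRatio ((2 * s : ℕ) * c') d τ := by
    rw [← sqrtRatio_scale hsR (c := (2 * s : ℕ) * c') (c' := 2 * c') (by push_cast; ring)]
    congr 1
  rw [sqrtRatio] at hR
  have harg : (a * (s * τ) + ((s * b : ℤ) : ℂ)) / (((2 * c' : ℤ) : ℂ) * (s * τ) + d) =
      s * ((a * τ + b) / (((2 * s : ℕ) * c' : ℤ) * τ + d)) := by
    push_cast
    ring
  rw [hR, thetaGauss_one _ hd, harg, thetaChar_one_half him, thetaChar_one_half him'] at h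
  refine mul_left_cancel₀ (two_ne_zero (α := ℂ)) (h.trans ?_)
  push_cast
  ring

/-! ### The character -/

lemma kroneckerSymbol_of_odd (a : ℤ) {n : ℤ} (hn : Odd n) :
    kroneckerSymbol a n = (if n < 0 ∧ a < 0 then -1 else 1) * J(a | n.natAbs) := by
  have h0 : n ≠ 0 := by rintro rfl; simp at hn
  have h2 : n.natAbs.factorization 2 = 0 :=
    Nat.factorization_eq_zero_of_not_dvd (Int.natAbs_odd.2 hn).not_two_dvd_nat
  rw [kroneckerSymbol, if_neg h0, h2]
  simp

lemma mixedDisc_neg_iff {v k : ℕ} {b : Fin v → ℕ} {c : Fin k → ℕ} (hb : ∀ i, 0 < b i)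
    (hc : ∀ j, 0 < c j) : mixedDisc b c < 0 ↔ Odd ((v + k) / 2) := by
  have hpos : (0 : ℤ) < (if Even v ∧ Even k then 4 else 8) * (∏ i, (b i : ℤ)) * ∏ j, (c j : ℤ) :=
    mul_pos (mul_pos (by split_ifs <;> norm_num)
      (Finset.prod_pos fun i _ => by exact_mod_cast hb i))
      (Finset.prod_pos fun j _ => by exact_mod_cast hc j)
  rw [mixedDisc, mul_assoc, mul_assoc, ← mul_assoc (ite _ _ _)]
  rcases Nat.even_or_odd ((v + k) / 2) with h | h
  · rw [h.neg_one_pow, one_mul]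
    exact ⟨fun h' => absurd hpos h'.le.not_gt, fun h' => absurd h (Nat.not_even_iff_odd.2 h')⟩
  · rw [h.neg_one_pow]
    exact ⟨fun _ => h, fun _ => by linarith⟩

lemma jacobiSym_prod {ι : Type*} (s : Finset ι) (f : ι → ℤ) (d : ℕ) :
    J(∏ i ∈ s, f i | d) = ∏ i ∈ s, J(f i | d) := by
  classical
  induction s using Finset.induction_on with
  | empty => simp
  | insert i s hi ih => rw [Finset.prod_insert hi, Finset.prod_insert hi, jacobiSym.mul_left, ih]

/-- The product of the Jacobi symbols of all Gauss sums is the symbol of the discriminant: the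
off-diagonal entry `β` enters an even number of times. -/
lemma jacobiSym_mixedDisc {v k : ℕ} (hvk : Even (v + k)) (b : Fin v → ℕ) (c : Fin k → ℕ) {d : ℕ}
    (hd : Odd d) {β : ℤ} (hβ : IsCoprime β d) :
    (∏ i, J(b i * β | d)) * (∏ j, J(2 * (c j * β) | d)) * J(-1 | d) ^ ((v + k) / 2) =
      J(mixedDisc b c | d) := by
  have hβ2 : J(β | d) ^ v * J(β | d) ^ k = 1 := by
    obtain ⟨w, hw⟩ := hvk
    rw [← pow_add, hw, ← two_mul, pow_mul, jacobiSym.sq_one (Int.isCoprime_iff_gcd_eq_one.1 hβ),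
      one_pow]
  have h22 : J(2 | d) ^ 2 = 1 := by
    rw [← jacobiSym.pow_left]; exact jacobiSym.at_four hd
  have h2 : J(2 | d) ^ k = J(if Even v ∧ Even k then 4 else 8 | d) := by
    split_ifs with h
    · obtain ⟨m, rfl⟩ := h.2
      rw [← two_mul, pow_mul, h22, one_pow, jacobiSym.at_four hd]
    · have hk : Odd k := by
        rw [← Nat.not_even_iff_odd]
        intro hk
        exact h ⟨(Nat.even_add.1 hvk).2 hk, hk⟩
      obtain ⟨m, rfl⟩ := hk
      rw [pow_succ, pow_mul, h22, one_pow, one_mul, show (8 : ℤ) = 4 * 2 by norm_num,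
        jacobiSym.mul_left, jacobiSym.at_four hd, one_mul]
  simp only [mixedDisc, jacobiSym.mul_left, jacobiSym.pow_left, jacobiSym_prod,
    Finset.prod_mul_distrib, Finset.prod_const, Finset.card_univ, Fintype.card_fin]
  rw [← h2]
  linear_combination (J(2 | d) ^ k * (∏ i, J(b i | d)) * (∏ j, J(c j | d)) *
    J(-1 | d) ^ ((v + k) / 2)) * hβ2

/-! ### The transformation law of the product -/

/-- The transformation law for a matrix with positive lower right entry `δ`. The `v + k` square
roots are equal, so their product is an integral power of `(γ τ + δ) / δ`. The eighth roots of
unity from the triangular factors multiply to `exp (2 π i h β δ / 8)`, which is trivial when `8`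
divides `h = ∑ c_j`, and the Gauss sums multiply to `δ ^ ((v + k) / 2)` times the character. -/
lemma prod_squareTheta_shiftedPsi_smul {v k : ℕ} (hvk : Even (v + k)) {b : Fin v → ℕ}
    {c : Fin k → ℕ} (hb : ∀ i, 0 < b i) (hc : ∀ j, 0 < c j) (h8 : 8 ∣ ∑ j, c j) {α β γ : ℤ} {δ : ℕ} (hδ : Odd δ)
    (hdet : α * δ - β * γ = 1) (hbγ : ∀ i, ((4 * b i : ℕ) : ℤ) ∣ γ)
    (hcγ : ∀ j, ((2 * c j : ℕ) : ℤ) ∣ γ) {τ : ℂ} (hτ : 0 < τ.im)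
    (hγτ : 0 < ((α * τ + β) / (γ * τ + δ) : ℂ).im) :
    (∏ i, squareTheta (b i * ((α * τ + β) / (γ * τ + δ)))) *
        ∏ j, shiftedPsi (c j * ((α * τ + β) / (γ * τ + δ))) =
      J(mixedDisc b c | δ) * (γ * τ + δ) ^ ((v + k) / 2) *
        ((∏ i, squareTheta (b i * τ)) * ∏ j, shiftedPsi (c j * τ)) := by
  have : NeZero δ := ⟨hδ.pos.ne'⟩
  have hδ0 : (δ : ℂ) ≠ 0 := NeZero.ne _
  obtain ⟨hG1, hG⟩ := quadGauss_eq_jacobiSym_mul_and_sq δ hδ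
  have hβ : IsCoprime β (δ : ℤ) := ⟨-γ, α, by linear_combination hdet⟩
  have hγδ : IsCoprime γ (δ : ℤ) := ⟨-β, α, by linear_combination hdet⟩
  have hcopb : ∀ i, IsCoprime ((b i : ℤ) * β) (δ : ℤ) := fun i =>
    (hγδ.of_isCoprime_of_dvd_left ((Dvd.intro_left 4 (by push_cast; rfl)).trans (hbγ i))).mul_left
      hβ
  have hcopc : ∀ j, IsCoprime (2 * ((c j : ℤ) * β)) (δ : ℤ) := fun j => by
    rw [← mul_assoc]
    exact (hγδ.of_isCoprime_of_dvd_left (by simpa using hcγ j)).mul_left hβ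
  simp only [fun i => squareTheta_smul (hb i) hdet (hbγ i) hτ,
    fun j => shiftedPsi_smul (hc j) hdet (hcγ j) hδ hτ hγτ, Finset.prod_mul_distrib,
    Finset.prod_const, Finset.card_univ, Fintype.card_fin, ← Complex.exp_sum]
  have hexp : Complex.exp (∑ j, 2 * Real.pi * Complex.I * ((c j : ℂ) * β * δ / 8)) = 1 := by
    obtain ⟨m, hm⟩ := h8
    have hmC : ∑ j, (c j : ℂ) = 8 * m := by
      exact_mod_cast congrArg (Nat.cast : ℕ → ℂ) hm
    rw [← Finset.mul_sum, ← Finset.sum_div, ← Finset.sum_mul, ← Finset.sum_mul, hmC,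
      Complex.exp_eq_one_iff]
    exact ⟨m * β * δ, by push_cast; ring⟩
  have hgb : ∏ i, quadGauss (b i * β) δ =
      ((∏ i, J(b i * β | δ) : ℤ) : ℂ) * quadGauss 1 δ ^ v := by
    simp only [fun i => hG _ (hcopb i), Finset.prod_mul_distrib, Finset.prod_const,
      Finset.card_univ, Fintype.card_fin]
    push_cast
    rfl
  have hgc : ∏ j, quadGauss (2 * (c j * β)) δ =
      ((∏ j, J(2 * (c j * β) | δ) : ℤ) : ℂ) * quadGauss 1 δ ^ k := by
    simp only [fun j => hG _ (hcopc j), Finset.prod_mul_distrib, Finset.prod_const,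
      Finset.card_univ, Fintype.card_fin]
    push_cast
    rfl
  have hJ := congrArg (Int.cast : ℤ → ℂ) (jacobiSym_mixedDisc hvk b c hδ hβ)
  rw [Int.cast_mul, Int.cast_mul, Int.cast_pow] at hJ
  set w := (v + k) / 2 with hw
  have hvk2 : v + k = 2 * w := by obtain ⟨m, hm⟩ := hvk; omega
  have hG2 : quadGauss 1 δ ^ v * quadGauss 1 δ ^ k = (J(-1 | δ) : ℂ) ^ w * δ ^ w := by
    rw [← pow_add, hvk2, pow_mul, hG1, mul_pow]
  have hR : sqrtRatio γ δ τ ^ v * sqrtRatio γ δ τ ^ k = (γ * τ + δ) ^ w / δ ^ w := by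
    rw [← pow_add, hvk2, pow_mul, sqrtRatio_sq hτ, div_pow]
  rw [hexp, hgb, hgc, ← hJ]
  calc _ = ((∏ i, J(b i * β | δ) : ℤ) : ℂ) * ((∏ j, J(2 * (c j * β) | δ) : ℤ) : ℂ) *
        (quadGauss 1 δ ^ v * quadGauss 1 δ ^ k) *
        (sqrtRatio γ δ τ ^ v * sqrtRatio γ δ τ ^ k) *
        ((∏ i, squareTheta (b i * τ)) * ∏ j, shiftedPsi (c j * τ)) := by ring
    _ = _ := by
      rw [hG2, hR]
      field_simp

/-- The function `q ^ (h / 8) ψ`, where `h = ∑ c_j`, as a product of theta series, each triangular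
factor carrying its own share `q ^ (c_j / 8)` of the prefactor. -/
noncomputable def mixedForm {v k : ℕ} (b : Fin v → ℕ) (c : Fin k → ℕ) (τ : ℍ) : ℂ :=
  (∏ i, squareTheta (b i * τ)) * ∏ j, shiftedPsi (c j * τ)

lemma dvd_mixedLevel_left {v k : ℕ} (b : Fin v → ℕ) (c : Fin k → ℕ) (i : Fin v) :
    4 * b i ∣ mixedLevel b c :=
  (mul_dvd_mul_left 4 (Finset.dvd_lcm (Finset.mem_univ i))).trans (Nat.dvd_lcm_left _ _)

lemma dvd_mixedLevel_right {v k : ℕ} (b : Fin v → ℕ) (c : Fin k → ℕ) (j : Fin k) :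
    2 * c j ∣ mixedLevel b c :=
  (mul_dvd_mul_left 2 (Finset.dvd_lcm (Finset.mem_univ j))).trans (Nat.dvd_lcm_right _ _)

lemma four_dvd_mixedLevel {v k : ℕ} (b : Fin v → ℕ) (c : Fin k → ℕ) : 4 ∣ mixedLevel b c :=
  (Dvd.intro _ rfl).trans (Nat.dvd_lcm_left _ _)

lemma odd_of_mem_Gamma0_mixedLevel {v k : ℕ} {b : Fin v → ℕ} {c : Fin k → ℕ} {g : SL(2, ℤ)}
    (hg : g ∈ Gamma0 (mixedLevel b c)) : Odd (g 1 1) := by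
  rw [Gamma0_mem, ZMod.intCast_zmod_eq_zero_iff_dvd] at hg
  have hdet : g 0 0 * g 1 1 - g 0 1 * g 1 0 = 1 := by
    rw [← Matrix.det_fin_two]; exact g.det_coe
  have h4 : (4 : ℤ) ∣ g 1 0 := (Int.natCast_dvd_natCast.2 (four_dvd_mixedLevel b c)).trans hg
  have : Odd (g 0 0 * g 1 1) := by
    rw [show g 0 0 * g 1 1 = g 0 1 * g 1 0 + 1 by linarith]
    exact (((even_iff_two_dvd.2 ((by norm_num : (2 : ℤ) ∣ 4).trans h4))).mul_left _).add_one
  exact (Int.odd_mul.1 this).2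

lemma mixedForm_smul_of_pos {v k : ℕ} (hvk : Even (v + k)) {b : Fin v → ℕ} {c : Fin k → ℕ}
    (hb : ∀ i, 0 < b i) (hc : ∀ j, 0 < c j) (h8 : 8 ∣ ∑ j, c j) {g : SL(2, ℤ)}
    (hg : g ∈ Gamma0 (mixedLevel b c)) (hpos : 0 < g 1 1) (τ : ℍ) :
    mixedForm b c (g • τ) = kroneckerSymbol (mixedDisc b c) (g 1 1) *
      ((g 1 0 : ℂ) * τ + g 1 1) ^ ((v + k) / 2) * mixedForm b c τ := by
  have hM : (mixedLevel b c : ℤ) ∣ g 1 0 := by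
    rwa [Gamma0_mem, ZMod.intCast_zmod_eq_zero_iff_dvd] at hg
  have hdet : g 0 0 * g 1 1 - g 0 1 * g 1 0 = 1 := by
    rw [← Matrix.det_fin_two]; exact g.det_coe
  have hodd := odd_of_mem_Gamma0_mixedLevel hg
  obtain ⟨δ, hδ⟩ := Int.eq_ofNat_of_zero_le hpos.le
  have hcoe : ((g • τ : ℍ) : ℂ) = (g 0 0 * τ + g 0 1) / (g 1 0 * τ + δ) := by
    rw [coe_specialLinearGroup_apply, hδ]
    simp
  have hδodd : Odd δ := by rw [hδ] at hodd; exact_mod_cast hodd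
  rw [kroneckerSymbol_of_odd _ hodd, if_neg (fun h => hpos.not_gt h.1), one_mul, hδ,
    Int.natAbs_natCast, mixedForm, mixedForm, hcoe]
  refine (prod_squareTheta_shiftedPsi_smul hvk hb hc h8 hδodd (by rw [← hδ]; exact hdet)
    (fun i => (Int.natCast_dvd_natCast.2 (dvd_mixedLevel_left b c i)).trans hM)
    (fun j => (Int.natCast_dvd_natCast.2 (dvd_mixedLevel_right b c j)).trans hM) τ.im_pos
    (by rw [← hcoe]; exact (g • τ).im_pos)).trans ?_
  simp

/-- Replacing `g` by `-g` gives the case of a negative lower right entry: the sign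
`(-1) ^ ((v + k) / 2)` of the automorphy factor is `(D / -1)`, since it is the sign of the
discriminant `D`. -/
lemma mixedForm_smul {v k : ℕ} (hvk : Even (v + k)) {b : Fin v → ℕ} {c : Fin k → ℕ}
    (hb : ∀ i, 0 < b i) (hc : ∀ j, 0 < c j) (h8 : 8 ∣ ∑ j, c j) {g : SL(2, ℤ)}
    (hg : g ∈ Gamma0 (mixedLevel b c)) (τ : ℍ) :
    mixedForm b c (g • τ) = kroneckerSymbol (mixedDisc b c) (g 1 1) *
      ((g 1 0 : ℂ) * τ + g 1 1) ^ ((v + k) / 2) * mixedForm b c τ := by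
  have hodd := odd_of_mem_Gamma0_mixedLevel hg
  rcases lt_trichotomy (g 1 1) 0 with hneg | hz | hpos
  · have hg' : -g ∈ Gamma0 (mixedLevel b c) := by
      rw [Gamma0_mem] at hg ⊢
      simp [hg]
    have h := mixedForm_smul_of_pos hvk hb hc h8 hg' (by simpa using hneg) τ
    rw [ModularGroup.SL_neg_smul] at h
    rw [h]
    have h1 : (-g) 1 1 = -(g 1 1) := by simp
    have h2 : (-g) 1 0 = -(g 1 0) := by simp
    rw [h1, h2, kroneckerSymbol_of_odd _ hodd, kroneckerSymbol_of_odd _ hodd.neg, Int.natAbs_neg,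
      if_neg (by rintro ⟨h, -⟩; linarith)]
    have h3 : ((-(g 1 0) : ℤ) : ℂ) * τ + ((-(g 1 1) : ℤ) : ℂ) =
        -1 * ((g 1 0 : ℂ) * τ + g 1 1) := by push_cast; ring
    rw [h3, mul_pow]
    rcases Nat.even_or_odd ((v + k) / 2) with hw | hw
    · rw [hw.neg_one_pow, if_neg]
      · ring
      · rintro ⟨-, h⟩
        exact Nat.not_even_iff_odd.2 ((mixedDisc_neg_iff hb hc).1 h) hw
    · rw [hw.neg_one_pow, if_pos ⟨hneg, (mixedDisc_neg_iff hb hc).2 hw⟩]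
      push_cast
      ring
  · rw [hz] at hodd
    simp at hodd
  · exact mixedForm_smul_of_pos hvk hb hc h8 hg hpos τ

/-! ### Holomorphy and growth -/

lemma differentiableAt_squareTheta {z : ℂ} (hz : 0 < z.im) : DifferentiableAt ℂ squareTheta z := by
  have h : squareTheta = jacobiTheta ∘ fun z => 2 * z := funext squareTheta_eq_jacobiTheta
  rw [h]
  exact (differentiableAt_jacobiTheta (by simpa using hz)).comp z (by fun_prop)

lemma differentiableAt_shiftedPsi {z : ℂ} (hz : 0 < z.im) : DifferentiableAt ℂ shiftedPsi z := by
  have h : shiftedPsi =ᶠ[nhds z] fun z => (squareTheta (z / 8) - squareTheta (z / 2)) / 2 := by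
    filter_upwards [isOpen_upperHalfPlaneSet.mem_nhds hz] with u hu
    rw [← two_mul_shiftedPsi hu, mul_div_cancel_left₀ _ two_ne_zero]
  rw [h.differentiableAt_iff]
  have h8 : 0 < (z / 8).im := by simpa using hz
  have h2 : 0 < (z / 2).im := by simpa using hz
  have d8 : DifferentiableAt ℂ (fun u : ℂ => squareTheta (u / 8)) z :=
    (differentiableAt_squareTheta h8).comp (f := fun u : ℂ => u / 8) z (by fun_prop)
  have d2 : DifferentiableAt ℂ (fun u : ℂ => squareTheta (u / 2)) z :=
    (differentiableAt_squareTheta h2).comp (f := fun u : ℂ => u / 2) z (by fun_prop)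
  exact (d8.sub d2).div_const 2

lemma mdifferentiable_mixedForm {v k : ℕ} {b : Fin v → ℕ} {c : Fin k → ℕ}
    (hb : ∀ i, 0 < b i) (hc : ∀ j, 0 < c j) : MDiff (mixedForm b c) := by
  rw [mdifferentiable_iff]
  have h : DifferentiableOn ℂ
      (fun z : ℂ => (∏ i, squareTheta (b i * z)) * ∏ j, shiftedPsi (c j * z)) {z | 0 < z.im} := by
    intro z hz
    have him : ∀ n : ℕ, 0 < n → 0 < ((n : ℂ) * z).im := fun n hn => by
      rw [← Complex.ofReal_natCast n, Complex.im_ofReal_mul]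
      exact mul_pos (Nat.cast_pos.2 hn) hz
    refine DifferentiableAt.differentiableWithinAt (DifferentiableAt.mul ?_ ?_)
    · exact DifferentiableAt.fun_finsetProd fun i _ =>
        (differentiableAt_squareTheta (him _ (hb i))).comp z (by fun_prop)
    · exact DifferentiableAt.fun_finsetProd fun j _ =>
        (differentiableAt_shiftedPsi (him _ (hc j))).comp z (by fun_prop)
  refine h.congr fun z hz => ?_
  simp [mixedForm, ofComplex_apply_of_im_pos hz]

/-- On a horizontal line a theta series is largest on the imaginary axis. -/
lemma norm_jacobiTheta_le {τ : ℂ} (hτ : 0 < τ.im) :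
    ‖jacobiTheta τ‖ ≤ ‖jacobiTheta (Complex.I * τ.im)‖ := by
  have hn : ∀ n : ℤ, ‖Complex.exp (Real.pi * Complex.I * (n : ℂ) ^ 2 * τ)‖ =
      Real.exp (-Real.pi * n ^ 2 * τ.im) := fun n => by
    rw [Complex.norm_exp]
    congr 1
    have : (Real.pi * Complex.I * (n : ℂ) ^ 2 * τ : ℂ) =
        ((Real.pi * n ^ 2 : ℝ) : ℂ) * (Complex.I * τ) := by push_cast; ring
    rw [this, Complex.re_ofReal_mul, Complex.I_mul_re]
    ring
  have hs : Summable fun n : ℤ => ‖Complex.exp (Real.pi * Complex.I * (n : ℂ) ^ 2 * τ)‖ := by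
    have := (summable_thetaChar 0 hτ).norm
    simpa only [add_zero] using this
  have he : jacobiTheta (Complex.I * τ.im) =
      ((∑' n : ℤ, Real.exp (-Real.pi * n ^ 2 * τ.im) : ℝ) : ℂ) := by
    rw [jacobiTheta, Complex.ofReal_tsum]
    refine tsum_congr fun n => ?_
    rw [Complex.ofReal_exp]
    congr 1
    push_cast
    linear_combination (Real.pi * (n : ℂ) ^ 2 * τ.im) * Complex.I_mul_I
  rw [he, Complex.norm_real, Real.norm_of_nonneg (tsum_nonneg fun n => (Real.exp_pos _).le)]
  simp only [← hn]
  exact norm_tsum_le_tsum_norm hs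

/-- A theta series of weight `1 / 2` grows at most like `y ^ (-1 / 2)` towards the real line. -/
lemma exists_norm_squareTheta_le : ∃ C : ℝ, 0 < C ∧ ∀ z : ℂ, 0 < z.im →
    ‖squareTheta z‖ ≤ C * (1 + 1 / √z.im) := by
  have hpi := Real.pi_pos
  have he1 : 0 < 1 - Real.exp (-Real.pi) := by
    rw [sub_pos, Real.exp_lt_one_iff]; linarith
  set K : ℝ := 1 + 2 / (1 - Real.exp (-Real.pi)) with hK
  have hK0 : 0 < K := by positivity
  have hlarge : ∀ y : ℝ, 1 ≤ y → ‖jacobiTheta (Complex.I * y)‖ ≤ K := by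
    intro y hy
    have him : (Complex.I * y : ℂ).im = y := by simp
    have h := norm_jacobiTheta_sub_one_le (τ := Complex.I * y) (by rw [him]; linarith)
    rw [him] at h
    have h1 : Real.exp (-Real.pi * y) ≤ Real.exp (-Real.pi) :=
      Real.exp_le_exp.2 (by nlinarith)
    have h2 : 2 / (1 - Real.exp (-Real.pi * y)) * Real.exp (-Real.pi * y) ≤
        2 / (1 - Real.exp (-Real.pi)) * 1 := by
      refine mul_le_mul ?_ (by linarith) (Real.exp_pos _).le (by positivity)
      exact div_le_div_of_nonneg_left zero_le_two he1 (by linarith)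
    have h3 := norm_add_le (jacobiTheta (Complex.I * y) - 1) 1
    rw [sub_add_cancel, norm_one] at h3
    linarith
  have hsmall : ∀ y : ℝ, 0 < y → y ≤ 1 → ‖jacobiTheta (Complex.I * y)‖ ≤ K * (1 / √y) := by
    intro y hy hy1
    have hyC : (y : ℂ) ≠ 0 := Complex.ofReal_ne_zero.2 hy.ne'
    have hinv : -1 / (Complex.I * y) = Complex.I * ((1 / y : ℝ) : ℂ) := by
      have := Complex.I_ne_zero
      push_cast
      field_simp
      simp
    have hI : -Complex.I * (Complex.I * y) = y := by
      linear_combination -(y : ℂ) * Complex.I_mul_I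
    rw [jacobiTheta_eq_jacobiTheta₂, jacobiTheta₂_functional_equation, zero_div, hinv, hI,
      ← jacobiTheta_eq_jacobiTheta₂, norm_mul, norm_mul, norm_div, norm_one,
      Complex.norm_cpow_eq_rpow_re_of_pos hy, mul_comm]
    have hre : (1 / 2 : ℂ).re = 1 / 2 := by simp
    have hexp : ‖Complex.exp (-Real.pi * Complex.I * 0 ^ 2 / (Complex.I * y))‖ = 1 := by simp
    rw [hexp, hre, ← Real.sqrt_eq_rpow, mul_one]
    exact mul_le_mul_of_nonneg_right (hlarge _ ((one_le_div hy).2 hy1)) (by positivity)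
  refine ⟨K, hK0, fun z hz => ?_⟩
  have him : (2 * z).im = 2 * z.im := by simp
  rw [squareTheta_eq_jacobiTheta]
  refine (norm_jacobiTheta_le (by rw [him]; linarith)).trans ?_
  rw [him]
  have hsq : 1 / √(2 * z.im) ≤ 1 / √z.im :=
    one_div_le_one_div_of_le (Real.sqrt_pos.2 hz) (Real.sqrt_le_sqrt (by linarith))
  have hs0 : 0 ≤ 1 / √z.im := by positivity
  rcases le_total 1 (2 * z.im) with h | h
  · exact (hlarge _ h).trans (by nlinarith)
  · exact (hsmall _ (by linarith) h).trans (by nlinarith)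

lemma exists_norm_shiftedPsi_le : ∃ C : ℝ, 0 < C ∧ ∀ z : ℂ, 0 < z.im →
    ‖shiftedPsi z‖ ≤ C * (1 + 1 / √z.im) := by
  obtain ⟨C, hC, h⟩ := exists_norm_squareTheta_le
  have hscale : ∀ y m : ℝ, 0 < y → 0 < m → m ≤ 9 → 1 / √(y / m) ≤ 3 * (1 / √y) := by
    intro y m hy hm hm9
    rw [Real.sqrt_div hy.le, one_div_div, div_eq_mul_one_div]
    refine mul_le_mul_of_nonneg_right ?_ (by positivity)
    rw [Real.sqrt_le_left (by norm_num)]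
    linarith
  refine ⟨3 * C, by positivity, fun z hz => ?_⟩
  have i8 : (z / 8).im = z.im / 8 := by simp
  have i2 : (z / 2).im = z.im / 2 := by simp
  have h8 := h (z / 8) (by rw [i8]; positivity)
  have h2 := h (z / 2) (by rw [i2]; positivity)
  rw [i8] at h8
  rw [i2] at h2
  have s8 := hscale z.im 8 hz (by norm_num) (by norm_num)
  have s2 := hscale z.im 2 hz (by norm_num) (by norm_num)
  have hn : 2 * ‖shiftedPsi z‖ ≤ ‖squareTheta (z / 8)‖ + ‖squareTheta (z / 2)‖ := by
    rw [← Complex.norm_two, ← norm_mul, two_mul_shiftedPsi hz]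
    exact norm_sub_le _ _
  nlinarith [mul_le_mul_of_nonneg_left s8 hC.le, mul_le_mul_of_nonneg_left s2 hC.le]

/-! ### Boundedness at the cusps -/

lemma exists_norm_mixedForm_le {v k : ℕ} {b : Fin v → ℕ} {c : Fin k → ℕ}
    (hb : ∀ i, 0 < b i) (hc : ∀ j, 0 < c j) :
    ∃ C : ℝ, 0 ≤ C ∧ ∀ τ : ℍ, ‖mixedForm b c τ‖ ≤ C * (1 + 1 / √τ.im) ^ (v + k) := by
  obtain ⟨C₁, hC₁, h₁⟩ := exists_norm_squareTheta_le
  obtain ⟨C₂, hC₂, h₂⟩ := exists_norm_shiftedPsi_le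
  refine ⟨C₁ ^ v * C₂ ^ k, by positivity, fun τ => ?_⟩
  have him : ∀ n : ℕ, ((n : ℂ) * τ).im = n * τ.im := fun n => by
    rw [← Complex.ofReal_natCast n, Complex.im_ofReal_mul]; rfl
  have hpos : ∀ n : ℕ, 0 < n → 0 < ((n : ℂ) * τ).im := fun n hn => by
    rw [him]; exact mul_pos (Nat.cast_pos.2 hn) τ.im_pos
  have hle : ∀ n : ℕ, 0 < n → 1 + 1 / √((n : ℂ) * τ).im ≤ 1 + 1 / √τ.im := fun n hn => by
    have h1 : (1 : ℝ) ≤ n := Nat.one_le_cast.2 hn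
    have h2 := τ.im_pos
    rw [him]
    gcongr
    nlinarith
  have hb' : ‖∏ i, squareTheta (b i * τ)‖ ≤ (C₁ * (1 + 1 / √τ.im)) ^ v := by
    rw [norm_prod]
    refine (Finset.prod_le_prod (fun _ _ => norm_nonneg _) (fun i _ =>
      (h₁ _ (hpos _ (hb i))).trans (mul_le_mul_of_nonneg_left (hle _ (hb i)) hC₁.le))).trans ?_
    simp
  have hc' : ‖∏ j, shiftedPsi (c j * τ)‖ ≤ (C₂ * (1 + 1 / √τ.im)) ^ k := by
    rw [norm_prod]
    refine (Finset.prod_le_prod (fun _ _ => norm_nonneg _) (fun j _ =>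
      (h₂ _ (hpos _ (hc j))).trans (mul_le_mul_of_nonneg_left (hle _ (hc j)) hC₂.le))).trans ?_
    simp
  rw [mixedForm, norm_mul]
  refine (mul_le_mul hb' hc' (norm_nonneg _) (by positivity)).trans (le_of_eq ?_)
  rw [mul_pow, mul_pow, pow_add]
  ring

/-- A function of weight `w` that is invariant up to a bounded character under `Γ₀(N)` and grows
at most like `(1 + y ^ (-1 / 2)) ^ (2 w)` is bounded at every cusp. By translation invariance it
suffices to bound the transform by `γ` in a vertical strip, where `1 ≤ |c τ + d| ≤ B y` for a
constant `B`. -/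
lemma isBoundedAtImInfty_slash_of_growth {N : ℕ} (hN : 0 < N) {w : ℕ} {f : ℍ → ℂ} {χ : ℤ → ℂ}
    (hχ : ∀ n, ‖χ n‖ ≤ 1)
    (hf : ∀ g ∈ Gamma0 N, ∀ τ : ℍ,
      f (g • τ) = χ (g 1 1) * ((g 1 0 : ℂ) * (τ : ℂ) + (g 1 1 : ℂ)) ^ (w : ℤ) * f τ)
    {C : ℝ} (hC : 0 ≤ C) (hgrowth : ∀ τ : ℍ, ‖f τ‖ ≤ C * (1 + 1 / √τ.im) ^ (2 * w))
    (γ : SL(2, ℤ)) : IsBoundedAtImInfty (f ∣[(w : ℤ)] γ) := by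
  have hslash : ∀ g ∈ Gamma0 N, f ∣[(w : ℤ)] g = χ (g 1 1) • f := by
    intro g hg
    ext τ
    have hden : denom g τ = (g 1 0 : ℂ) * (τ : ℂ) + (g 1 1 : ℂ) := by simp [denom]
    rw [ModularForm.SL_slash_apply, hf g hg, hden, Pi.smul_apply, smul_eq_mul, mul_right_comm,
      mul_assoc (χ _), ← zpow_add₀ (hden ▸ denom_ne_zero g τ), add_neg_cancel, zpow_zero, mul_one]
  have hper : ∀ (n : ℤ) (τ : ℍ),
      ‖(f ∣[(w : ℤ)] γ) ((ModularGroup.T ^ (N * n)) • τ)‖ ≤ ‖(f ∣[(w : ℤ)] γ) τ‖ := by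
    intro n τ
    have hT : ModularGroup.T ^ ((N : ℤ) * n) ∈ Gamma N := by
      rw [Gamma_mem, ModularGroup.coe_T_zpow]
      simp
    set h : SL(2, ℤ) := γ * ModularGroup.T ^ ((N : ℤ) * n) * γ⁻¹ with hh
    have hG : h ∈ Gamma0 N := by
      have h1 : h ∈ Gamma N := (Gamma_normal N).conj_mem _ hT γ
      rw [Gamma0_mem]
      exact (Gamma_mem.1 h1).2.2.1
    have key : (f ∣[(w : ℤ)] γ) ∣[(w : ℤ)] (ModularGroup.T ^ ((N : ℤ) * n)) =
        χ (h 1 1) • f ∣[(w : ℤ)] γ := by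
      rw [← SlashAction.slash_mul, show γ * ModularGroup.T ^ ((N : ℤ) * n) = h * γ by
        rw [hh, inv_mul_cancel_right], SlashAction.slash_mul, hslash h hG,
        ModularForm.SL_smul_slash]
    have hden : denom (ModularGroup.T ^ ((N : ℤ) * n) : SL(2, ℤ)) τ = 1 := by
      simp [denom, ModularGroup.coe_T_zpow, -map_zpow]
    have := congrFun key τ
    rw [ModularForm.SL_slash_apply, hden, one_zpow, mul_one, Pi.smul_apply] at this
    rw [this, norm_smul]
    exact mul_le_of_le_one_left (norm_nonneg _) (hχ _)
  rw [isBoundedAtImInfty_iff]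
  refine ⟨C * (2 + 2 * (|(γ 1 0 : ℝ)| * (N + 1) + |(γ 1 1 : ℝ)|)) ^ w, 1, fun τ hτ => ?_⟩
  -- translation into the strip `0 ≤ x < N`
  set n : ℤ := ⌊τ.re / N⌋ with hn
  set σ : ℍ := ModularGroup.T ^ (N * (-n)) • τ with hσ
  have hτσ : τ = ModularGroup.T ^ (N * n) • σ := by
    rw [hσ, smul_smul, ← zpow_add]
    simp
  have hσim : σ.im = τ.im := ModularGroup.im_T_zpow_smul τ _
  have hN' : (0 : ℝ) < N := Nat.cast_pos.2 hN
  have hσre : |σ.re| ≤ N := by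
    have h1 : σ.re = τ.re - N * n := by
      rw [hσ, ModularGroup.re_T_zpow_smul]
      push_cast
      ring
    have h2 := Int.floor_le (τ.re / N)
    have h3 := (Int.lt_floor_add_one (τ.re / N)).le
    rw [← hn, le_div_iff₀ hN'] at h2
    rw [← hn, div_le_iff₀ hN'] at h3
    rw [abs_le, h1]
    constructor <;> nlinarith
  rw [hτσ]
  refine (hper n σ).trans ?_
  have hy : 1 ≤ σ.im := hσim ▸ hτ
  have hy0 : 0 < σ.im := by linarith
  have hden : denom γ σ = (γ 1 0 : ℂ) * (σ : ℂ) + (γ 1 1 : ℂ) := by simp [denom]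
  set u : ℝ := ‖denom γ σ‖ with hu
  have husq : u ^ 2 = ((γ 1 0 : ℝ) * σ.re + γ 1 1) ^ 2 + ((γ 1 0 : ℝ) * σ.im) ^ 2 := by
    rw [hu, hden, Complex.sq_norm, Complex.normSq_apply]
    simp
    ring
  have hu1 : 1 ≤ u := by
    have hu0 : 0 ≤ u := norm_nonneg _
    have hsq : ∀ m : ℤ, m ≠ 0 → (1 : ℝ) ≤ (m : ℝ) ^ 2 := fun m hm => by
      exact_mod_cast Int.one_le_abs (pow_ne_zero 2 hm) |>.trans (abs_of_nonneg (sq_nonneg m)).le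
    suffices (1 : ℝ) ≤ u ^ 2 by nlinarith
    rw [husq]
    by_cases hc : γ 1 0 = 0
    · have hdet : γ 0 0 * γ 1 1 - γ 0 1 * γ 1 0 = 1 := by
        rw [← Matrix.det_fin_two]; exact γ.det_coe
      have hd : γ 1 1 ≠ 0 := by
        intro hd
        rw [hc, hd] at hdet
        simp at hdet
      have := hsq _ hd
      rw [hc]
      simpa using this
    · have h1 := hsq _ hc
      nlinarith [sq_nonneg ((γ 1 0 : ℝ) * σ.re + γ 1 1), mul_pow (γ 1 0 : ℝ) σ.im 2]
  have hu0 : 0 < u := by linarith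
  set B : ℝ := |(γ 1 0 : ℝ)| * (N + 1) + |(γ 1 1 : ℝ)| with hB
  have huy : u ≤ σ.im * B := by
    have h1 : u ≤ |(γ 1 0 : ℝ)| * (|σ.re| + |σ.im|) + |(γ 1 1 : ℝ)| := by
      rw [hu, hden]
      refine (norm_add_le _ _).trans ?_
      rw [norm_mul, Complex.norm_intCast, Complex.norm_intCast]
      gcongr
      exact Complex.norm_le_abs_re_add_abs_im _
    rw [abs_of_pos hy0] at h1
    refine h1.trans ?_
    have h2 : |(γ 1 0 : ℝ)| * (|σ.re| + σ.im) ≤ |(γ 1 0 : ℝ)| * (σ.im * (N + 1)) := by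
      gcongr
      nlinarith
    have h3 : |(γ 1 1 : ℝ)| ≤ σ.im * |(γ 1 1 : ℝ)| := le_mul_of_one_le_left (abs_nonneg _) hy
    rw [hB]
    linarith
  have him : 1 / √(γ • σ).im = u / √σ.im := by
    have : (γ • σ).im = σ.im / u ^ 2 := by
      rw [ModularGroup.im_smul_eq_div_normSq, hu, Complex.sq_norm]
    rw [this, Real.sqrt_div hy0.le, Real.sqrt_sq hu0.le, one_div_div]
  have hs : √σ.im ^ 2 = σ.im := Real.sq_sqrt hy0.le
  have hfrac : (1 + u / √σ.im) ^ 2 / u ≤ 2 + 2 * B := by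
    have h1 : (u / √σ.im) ^ 2 ≤ u * B := by
      rw [div_pow, hs, div_le_iff₀ hy0]
      nlinarith
    rw [div_le_iff₀ hu0]
    nlinarith [sq_nonneg (1 - u / √σ.im)]
  rw [ModularForm.SL_slash_apply, norm_mul, norm_zpow, ← hu, zpow_neg, zpow_natCast]
  calc ‖f (γ • σ)‖ * (u ^ w)⁻¹ ≤ C * (1 + u / √σ.im) ^ (2 * w) * (u ^ w)⁻¹ := by
        gcongr
        rw [← him]
        exact hgrowth _
    _ = C * ((1 + u / √σ.im) ^ 2 / u) ^ w := by
        rw [div_pow, ← pow_mul, mul_assoc, ← div_eq_mul_inv]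
    _ ≤ C * (2 + 2 * B) ^ w := by gcongr

/-! ### Translation by one and nonvanishing -/

lemma squareTheta_add_natCast (z : ℂ) (m : ℕ) : squareTheta (z + m) = squareTheta z := by
  refine tsum_congr fun n => ?_
  rw [mul_assoc, mul_assoc (2 * Real.pi * Complex.I : ℂ)]
  exact exp_two_pi_mul_eq (n ^ 2 * m) (by push_cast; ring)

lemma triangularPsi_add_natCast (z : ℂ) (m : ℕ) : triangularPsi (z + m) = triangularPsi z := by
  refine tsum_congr fun n => ?_
  rw [mul_assoc (2 * Real.pi * Complex.I : ℂ), mul_assoc (2 * Real.pi * Complex.I : ℂ)]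
  obtain ⟨u, hu⟩ := Nat.even_mul_succ_self n
  have huC : (n : ℂ) * (n + 1) = u + u := by exact_mod_cast congrArg (Nat.cast : ℕ → ℂ) hu
  exact exp_two_pi_mul_eq (u * m) (by push_cast; rw [huC]; ring)

lemma squareTheta_I_mul_ne_zero {y : ℝ} (hy : 0 < y) : squareTheta (y * Complex.I) ≠ 0 := by
  have h : squareTheta (y * Complex.I) =
      ((∑' n : ℤ, Real.exp (-2 * Real.pi * n ^ 2 * y) : ℝ) : ℂ) := by
    rw [squareTheta, Complex.ofReal_tsum]
    refine tsum_congr fun n => ?_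
    rw [Complex.ofReal_exp]
    congr 1
    push_cast
    linear_combination (2 * Real.pi * (n : ℂ) ^ 2 * y) * Complex.I_mul_I
  have hs : Summable fun n : ℤ => Real.exp (-2 * Real.pi * n ^ 2 * y) := by
    have him : 0 < (2 * (y * Complex.I) : ℂ).im := by simpa using hy
    refine (summable_thetaChar 0 him).norm.congr fun n => ?_
    have : (Real.pi * Complex.I * ((n : ℂ) + 0) ^ 2 * (2 * (y * Complex.I)) : ℂ) =
        ((-2 * Real.pi * n ^ 2 * y : ℝ) : ℂ) := by
      push_cast
      linear_combination (2 * Real.pi * (n : ℂ) ^ 2 * y) * Complex.I_mul_I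
    rw [this, Complex.norm_exp, Complex.ofReal_re]
  rw [h]
  exact Complex.ofReal_ne_zero.2 (hs.tsum_pos (fun n => (Real.exp_pos _).le) 0
    (Real.exp_pos _)).ne'

lemma triangularPsi_I_mul_ne_zero {y : ℝ} (hy : 0 < y) : triangularPsi (y * Complex.I) ≠ 0 := by
  have h : triangularPsi (y * Complex.I) =
      ((∑' n : ℕ, Real.exp (-Real.pi * (n * (n + 1)) * y) : ℝ) : ℂ) := by
    rw [triangularPsi, Complex.ofReal_tsum]
    refine tsum_congr fun n => ?_
    rw [Complex.ofReal_exp]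
    congr 1
    push_cast
    linear_combination (Real.pi * ((n : ℂ) * (n + 1)) * y) * Complex.I_mul_I
  have hs : Summable fun n : ℕ => Real.exp (-Real.pi * (n * (n + 1)) * y) := by
    refine Summable.of_nonneg_of_le (fun n => (Real.exp_pos _).le) (fun n => ?_)
      (Real.summable_exp_nat_mul_iff.2
        (neg_lt_zero.2 (mul_pos Real.pi_pos hy)))
    rw [Real.exp_le_exp]
    have := mul_pos Real.pi_pos hy
    nlinarith [mul_nonneg this.le (sq_nonneg (n : ℝ))]
  rw [h]
  exact Complex.ofReal_ne_zero.2 (hs.tsum_pos (fun n => (Real.exp_pos _).le) 0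
    (Real.exp_pos _)).ne'

lemma mixedGen_T_smul {v k : ℕ} (b : Fin v → ℕ) (c : Fin k → ℕ) (τ : ℍ) :
    mixedGen b c (ModularGroup.T • τ) = mixedGen b c τ := by
  have hcoe : ((ModularGroup.T • τ : ℍ) : ℂ) = τ + 1 := by
    have := ModularGroup.coe_T_zpow_smul_eq (z := τ) (n := 1)
    simpa using this
  simp only [mixedGen, hcoe, mul_add, mul_one, squareTheta_add_natCast, triangularPsi_add_natCast]

lemma mixedGen_I_ne_zero {v k : ℕ} {b : Fin v → ℕ} {c : Fin k → ℕ} (hb : ∀ i, 0 < b i)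
    (hc : ∀ j, 0 < c j) : mixedGen b c I ≠ 0 := by
  rw [mixedGen, coe_I]
  refine mul_ne_zero (Finset.prod_ne_zero_iff.2 fun i _ => ?_)
    (Finset.prod_ne_zero_iff.2 fun j _ => ?_)
  · exact_mod_cast squareTheta_I_mul_ne_zero (y := b i) (Nat.cast_pos.2 (hb i))
  · exact_mod_cast triangularPsi_I_mul_ne_zero (y := c j) (Nat.cast_pos.2 (hc j))

lemma norm_kroneckerSymbol_le_one (a n : ℤ) :
    ‖((kroneckerSymbol a n : ℤ) : ℂ)‖ ≤ 1 := by
  rw [Complex.norm_intCast]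
  have h3 : ∀ m : ℤ, m = 0 ∨ m = 1 ∨ m = -1 → |m| ≤ 1 := by rintro m (rfl | rfl | rfl) <;> simp
  have : |kroneckerSymbol a n| ≤ 1 := by
    rw [kroneckerSymbol]
    split_ifs
    · simp
    · simp
    all_goals
      rw [abs_mul, abs_mul, abs_pow]
      refine mul_le_one₀ (mul_le_one₀ (by simp) (by positivity)
        (pow_le_one₀ (abs_nonneg _) (h3 _ ?_))) (abs_nonneg _)
        (h3 _ (jacobiSym.trichotomy _ _))
      exact ZMod.isQuadratic_χ₈ _
  exact_mod_cast this

/-! ### The criterion -/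

theorem theorem1p4 (v k : ℕ) (hv : 0 < v) (hk : 0 < k) (hvk : Even (v + k))
    (b : Fin v → ℕ) (c : Fin k → ℕ) (hb : ∀ i, 0 < b i) (hc : ∀ j, 0 < c j) :
    (fun τ : ℍ =>
        Complex.exp (2 * Real.pi * Complex.I * ((∑ j, c j : ℕ) : ℂ) / 8 * (τ : ℂ)) *
          mixedGen b c τ) ∈
      modularFormSpace (mixedLevel b c) (((v + k) / 2 : ℕ) : ℤ)
        (fun d => (kroneckerSymbol (mixedDisc b c) d : ℂ)) ↔
    (∑ j, c j) ≡ 0 [MOD 8] := by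
  rw [Nat.modEq_zero_iff_dvd]
  constructor
  -- The translation `τ ↦ τ + 1` lies in `Γ₀(M)` and multiplies the function by `exp (2 π i h / 8)`.
  · rintro ⟨-, hf, -⟩
    have hT : ModularGroup.T ∈ Gamma0 (mixedLevel b c) := by
      rw [Gamma0_mem]
      simp [ModularGroup.T]
    have h := hf _ hT I
    have h11 : ModularGroup.T 1 1 = 1 := by simp [ModularGroup.T]
    have h10 : ModularGroup.T 1 0 = 0 := by simp [ModularGroup.T]
    have hχ : kroneckerSymbol (mixedDisc b c) 1 = 1 := by
      rw [kroneckerSymbol_of_odd _ odd_one]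
      simp
    have hcoe : ((ModularGroup.T • I : ℍ) : ℂ) = I + 1 := by
      have := ModularGroup.coe_T_zpow_smul_eq (z := I) (n := 1)
      simpa using this
    simp only [h11, h10, hχ, mixedGen_T_smul, hcoe, mul_add, mul_one, Complex.exp_add] at h
    have he : Complex.exp (2 * Real.pi * Complex.I * ((∑ j, c j : ℕ) : ℂ) / 8) = 1 := by
      refine mul_left_cancel₀ (mul_ne_zero (Complex.exp_ne_zero
        (2 * Real.pi * Complex.I * ((∑ j, c j : ℕ) : ℂ) / 8 * (I : ℍ)))
        (mixedGen_I_ne_zero hb hc)) ?_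
      simp only [Int.cast_zero, Int.cast_one, zero_mul, zero_add, one_zpow, one_mul] at h
      linear_combination h
    rw [Complex.exp_eq_one_iff] at he
    obtain ⟨n, hn⟩ := he
    have h8 : ((∑ j, c j : ℕ) : ℂ) = 8 * n := by
      refine mul_left_cancel₀ Complex.two_pi_I_ne_zero ?_
      linear_combination 8 * hn
    have : ((∑ j, c j : ℕ) : ℤ) = 8 * n := by exact_mod_cast h8
    exact Int.natCast_dvd_natCast.1 ⟨n, this⟩
  · intro h8
    have hform : (fun τ : ℍ =>
        Complex.exp (2 * Real.pi * Complex.I * ((∑ j, c j : ℕ) : ℂ) / 8 * (τ : ℂ)) *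
          mixedGen b c τ) = mixedForm b c := funext fun τ => exp_mul_mixedGen b c τ
    rw [hform]
    have hlaw : ∀ g ∈ Gamma0 (mixedLevel b c), ∀ τ : ℍ, mixedForm b c (g • τ) =
        (fun d : ℤ => (kroneckerSymbol (mixedDisc b c) d : ℂ)) (g 1 1) *
          ((g 1 0 : ℂ) * (τ : ℂ) + (g 1 1 : ℂ)) ^ (((v + k) / 2 : ℕ) : ℤ) * mixedForm b c τ :=
      fun g hg τ => by rw [zpow_natCast]; exact mixedForm_smul hvk hb hc h8 hg τ
    have hN : 0 < mixedLevel b c := by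
      refine Nat.lcm_pos (Nat.mul_pos (by norm_num) (Nat.pos_of_ne_zero ?_))
        (Nat.mul_pos (by norm_num) (Nat.pos_of_ne_zero ?_))
      · rw [Ne, Finset.lcm_eq_zero_iff]
        simpa using fun i => (hb i).ne'
      · rw [Ne, Finset.lcm_eq_zero_iff]
        simpa using fun j => (hc j).ne'
    obtain ⟨C, hC, hgrowth⟩ := exists_norm_mixedForm_le hb hc
    have h2 : v + k = 2 * ((v + k) / 2) := by
      obtain ⟨m, hm⟩ := hvk; omega
    exact ⟨mdifferentiable_mixedForm hb hc, hlaw, fun γ =>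
      isBoundedAtImInfty_slash_of_growth hN (norm_kroneckerSymbol_le_one _) hlaw hC
        (fun τ => h2 ▸ hgrowth τ) γ⟩
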